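/- Let $\mathbb H_{\mathbb C}$ be the algebra of complex $2\times 2$ matrices $Z=\begin{pmatrix} z_{11}&z_{12}\\ z_{21}&z_{22}\end{pmatrix}$, $N(Z)=\det Z$, and let $$\mathrm{Zh}=\mathbb C[z_{11},z_{12},z_{21},z_{22},N(Z)^{-1}]$$ be the algebra of polynomial functions on $\{Z : N(Z)\neq 0\}$. The Lie algebra $\mathfrak{gl}(2,\mathbb H_{\mathbb C})$ (the $2\times2$ matrices over $\mathbb H_{\mathbb C}$) acts on $\mathrm{Zh}$ by $\varpi_2$, the derivative at the identity of the action of $GL(2,\mathbb H_{\mathbb C})$ $$(\varpi_2(h)f)(Z)=\frac{f\bigl((aZ+b)(cZ+d)^{-1}\bigr)}{N(cZ+d)^2\,N(a'-Zc')},\qquad h^{-1}=\begin{pmatrix}a&b\\c&d\end{pmatrix},\quad h=\begin{pmatrix}a'&b'\\c'&d'\end{pmatrix}.$$ For $l=0,\tfrac12,1,\tfrac32,\dots$ and $m,n\in\{-l,-l+1,\dots,l\}$ put $$t^l_{n\,m}(Z)=\frac1{2\pi i}\oint (sz_{11}+z_{21})^{l-m}(sz_{12}+z_{22})^{l+m}s^{-l+n}\,\frac{ds}{s},$$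 the integral being taken once counterclockwise around the origin. Let $\mathrm{Zh}^+=\mathbb C[z_{11},z_{12},z_{21},z_{22}]$ and $\mathrm{Zh}_2^-=\{f\in\mathrm{Zh} : N(Z)^{-3}f(Z^{-1})\in\mathrm{Zh}^+\}$. Then, with $l,m,n$ ranging over all the values above and $k$ over the indicated integers, $$\begin{aligned} \mathrm{Zh}^+&=\mathrm{span}_{\mathbb C}\{t^l_{n\,m}(Z)N(Z)^k : k\ge 0\},\\ \mathrm{Zh}_2^-&=\mathrm{span}_{\mathbb C}\{t^l_{n\,m}(Z)N(Z)^k : k\le -(2l+3)\}, \end{aligned}$$ and we set $$\begin{aligned} I_2^-&=\mathrm{span}_{\mathbb C}\{t^l_{n\,m}(Z)N(Z)^k : k\le -2\},\\ I_2^+&=\mathrm{span}_{\mathbb C}\{t^l_{n\,m}(Z)N(Z)^k : k\ge -(2l+1)\},\\ J_2&=\mathrm{span}_{\mathbb C}\{t^l_{n\,m}(Z)N(Z)^k : -(2l+1)\le k\le -2\}. \end{aligned}$$ (1) These five spaces are $\mathfrak{gl}(2,\mathbb H_{\mathbb C})$-invariant, nonzero and different from $\mathrm{Zh}$, and $I_2^-+I_2^+=\mathrm{Zh}$.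 The invariant subspaces of $\mathrm{Zh}$ other than $0$ and $\mathrm{Zh}$ are exactly the sums of nonempty collections of these five spaces that do not contain both $I_2^-$ and $I_2^+$. (2) The sums $I_2^-+\mathrm{Zh}^+$, $\mathrm{Zh}^++J_2$, $\mathrm{Zh}_2^-+I_2^+$, $\mathrm{Zh}_2^-+J_2$ are direct. The subrepresentations $\mathrm{Zh}^+$, $\mathrm{Zh}_2^-$, $J_2$ and the quotients $$\mathrm{Zh}/(I_2^-\oplus\mathrm{Zh}^+)= I_2^+/(\mathrm{Zh}^+\oplus J_2),\qquad \mathrm{Zh}/(\mathrm{Zh}_2^-\oplus I_2^+)= I_2^- /(\mathrm{Zh}_2^-\oplus J_2)$$ (identified by the maps induced by the inclusions $I_2^\pm\subset\mathrm{Zh}$) are irreducible, and they are the irreducible components of $(\varpi_2,\mathrm{Zh})$: $\mathrm{Zh}$ has a finite composition series of invariant subspaces, and in every composition series the successive quotients are, up to order and isomorphism, these five representations, each occurring exactly once. -/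

import Mathlib

namespace Quat

noncomputable section

open Matrix Complex

/-- Complexified quaternions, realized as the algebra of complex `2 × 2` matrices.
The norm `N(Z)` is `Z.det`. -/
abbrev HC : Type := Matrix (Fin 2) (Fin 2) ℂ

/-- The group of invertible complexified quaternions, `{Z | N(Z) ≠ 0}`. -/
abbrev HCx : Type := HCˣ

/-- `gl(2, HC)`: the `2 × 2` matrices over `HC`. -/
abbrev gl2HC : Type := Matrix (Fin 2) (Fin 2) HC

/-- `GL(2, HC)`. -/
abbrev GL2HC : Type := gl2HCˣ

/-- The commutator bracket on `gl(2, HC)`. -/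
instance instLieRingGl : LieRing gl2HC := LieRing.ofAssociativeRing

instance instLieAlgebraGl : LieAlgebra ℂ gl2HC := LieAlgebra.ofAssociativeAlgebra

/-! ### The function spaces -/

/-- The coordinate function `z_{ij}` on `{N(Z) ≠ 0}`. -/
def coord (i j : Fin 2) : HCx → ℂ := fun Z => Z.val i j

/-- The function `N(Z)⁻¹` on `{N(Z) ≠ 0}`. -/
def invN : HCx → ℂ := fun Z => (Z.val.det)⁻¹

/-- `ℂ[z₁₁, z₁₂, z₂₁, z₂₂, N(Z)⁻¹]`, the algebra of polynomial functions on `{N(Z) ≠ 0}`. -/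
def Zh : Subalgebra ℂ (HCx → ℂ) :=
  Algebra.adjoin ℂ (Set.range (fun p : Fin 2 × Fin 2 => coord p.1 p.2) ∪ {invN})

/-- `ℂ[z₁₁, z₁₂, z₂₁, z₂₂]`, as functions on `{N(Z) ≠ 0}`. -/
def polyFun : Subalgebra ℂ (HCx → ℂ) :=
  Algebra.adjoin ℂ (Set.range (fun p : Fin 2 × Fin 2 => coord p.1 p.2))

/-- `Zh⁺`: the elements of `Zh` that are polynomial functions. -/
def ZhPlus : Submodule ℂ Zh where
  carrier := {f | (f : HCx → ℂ) ∈ polyFun}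
  zero_mem' := polyFun.zero_mem
  add_mem' := fun hf hg => polyFun.add_mem hf hg
  smul_mem' := fun c _ hf => polyFun.smul_mem hf c

/-- `Zh_m⁻`: the elements `f` of `Zh` that are regular at infinity with weight `m`, i.e.
such that `f(Z⁻¹) / N(Z)^(m+1)` is a polynomial function. -/
def ZhMinus (m : ℕ) : Submodule ℂ Zh where
  carrier := {f | (fun Z : HCx => (f : HCx → ℂ) Z⁻¹ / Z.val.det ^ (m + 1)) ∈ polyFun}
  zero_mem' := by
    have : (fun Z : HCx => ((0 : Zh) : HCx → ℂ) Z⁻¹ / Z.val.det ^ (m + 1)) = 0 := by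
      funext Z; simp
    simp only [Set.mem_ofPred_eq, this]
    exact polyFun.zero_mem
  add_mem' := by
    intro f g hf hg
    have := polyFun.add_mem hf hg
    have e : (fun Z : HCx => ((f + g : Zh) : HCx → ℂ) Z⁻¹ / Z.val.det ^ (m + 1)) =
        (fun Z : HCx => (f : HCx → ℂ) Z⁻¹ / Z.val.det ^ (m + 1)) +
        (fun Z : HCx => (g : HCx → ℂ) Z⁻¹ / Z.val.det ^ (m + 1)) := by
      funext Z; simp [add_div]
    simp only [Set.mem_ofPred_eq, e]
    exact this
  smul_mem' := by
    intro c f hf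
    have := polyFun.smul_mem hf c
    have e : (fun Z : HCx => ((c • f : Zh) : HCx → ℂ) Z⁻¹ / Z.val.det ^ (m + 1)) =
        c • (fun Z : HCx => (f : HCx → ℂ) Z⁻¹ / Z.val.det ^ (m + 1)) := by
      funext Z; simp [mul_div_assoc]
    simp only [Set.mem_ofPred_eq, e]
    exact this

/-! ### The group action and its derivative -/

/-- Extension of a function on `{N(Z) ≠ 0}` by zero to all of `HC`. -/
def ext0 (f : HCx → ℂ) : HC → ℂ := Function.extend Units.val f 0

/-- The action `ϖ_m` of `GL(2, HC)` on functions: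
`(ϖ_m(h) f)(Z) = f((aZ+b)(cZ+d)⁻¹) / (N(cZ+d)^m N(a'-Zc'))`, where
`h⁻¹ = (a b; c d)` and `h = (a' b'; c' d')`. -/
def varpiGroup (m : ℕ) (h : GL2HC) (f : HCx → ℂ) : HCx → ℂ := fun Z =>
  let g : gl2HC := (h⁻¹ : GL2HC).val
  let g' : gl2HC := h.val
  ext0 f ((g 0 0 * Z.val + g 0 1) * (g 1 0 * Z.val + g 1 1)⁻¹) /
    ((g 1 0 * Z.val + g 1 1).det ^ m * (g' 0 0 - Z.val * g' 1 0).det)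

theorem exp_add_comm (X Y : gl2HC) (h : Commute X Y) :
    NormedSpace.exp (X + Y) = NormedSpace.exp X * NormedSpace.exp Y :=
  open scoped Norms.Operator in NormedSpace.exp_add_of_commute (𝔸 := gl2HC) h

theorem exp_hasDerivAt (X : gl2HC) (i j k l : Fin 2) :
    HasDerivAt (fun t : ℂ => (NormedSpace.exp (t • X) : gl2HC) i j k l) (X i j k l) 0 := by
  let L0 : gl2HC →ₗ[ℂ] ℂ :=
    { toFun := fun Y => Y i j k l, map_add' := fun _ _ => rfl, map_smul' := fun _ _ => rfl }
  open scoped Norms.Operator in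
  have h0 := hasDerivAt_exp_smul_const (𝕂 := ℂ) (𝔸 := gl2HC) X 0
  open scoped Norms.Operator in
  let L : gl2HC →L[ℂ] ℂ := LinearMap.toContinuousLinearMap L0
  open scoped Norms.Operator in
  have h1 := L.hasFDerivAt.comp_hasDerivAt (0:ℂ) h0
  rw [zero_smul, NormedSpace.exp_zero, one_mul] at h1
  exact h1

/-- The one-parameter subgroup `t ↦ exp(tX)` of `GL(2, HC)`. -/
def expGL (X : gl2HC) (t : ℂ) : GL2HC where
  val := NormedSpace.exp (t • X)
  inv := NormedSpace.exp (-(t • X))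
  val_inv := by
    have h : Commute (t • X) (-(t • X)) := (Commute.refl _).neg_right
    exact (exp_add_comm _ _ h).symm.trans (by simp)
  inv_val := by
    have h : Commute (-(t • X)) (t • X) := (Commute.refl _).neg_left
    exact (exp_add_comm _ _ h).symm.trans (by simp)

/-- The differentiated action `ϖ_m` of `gl(2, HC)`. -/
def varpiFun (m : ℕ) (X : gl2HC) (f : HCx → ℂ) : HCx → ℂ := fun Z =>
  deriv (fun t : ℂ => varpiGroup m (expGL X t) f Z) 0


/-! ### The differentiated action preserves `Zh` -/

/-- Entrywise differentiability at `0` of a curve of matrices. -/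
def HasEntryDeriv (P : ℂ → HC) (P' : HC) : Prop :=
  ∀ i j, HasDerivAt (fun t => P t i j) (P' i j) 0

theorem HasEntryDeriv.add {P Q : ℂ → HC} {P' Q' : HC} (hP : HasEntryDeriv P P')
    (hQ : HasEntryDeriv Q Q') : HasEntryDeriv (fun t => P t + Q t) (P' + Q') :=
  fun i j => (hP i j).add (hQ i j)

theorem HasEntryDeriv.mul_const {P : ℂ → HC} {P' : HC} (hP : HasEntryDeriv P P') (Z : HC) :
    HasEntryDeriv (fun t => P t * Z) (P' * Z) := by
  intro i j
  simp only [Matrix.mul_apply, Fin.sum_univ_two]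
  exact ((hP i 0).mul_const _).add ((hP i 1).mul_const _)

theorem HasEntryDeriv.const_mul {P : ℂ → HC} {P' : HC} (hP : HasEntryDeriv P P') (Z : HC) :
    HasEntryDeriv (fun t => Z * P t) (Z * P') := by
  intro i j
  simp only [Matrix.mul_apply, Fin.sum_univ_two]
  exact ((hP 0 j).const_mul _).add ((hP 1 j).const_mul _)

theorem HasEntryDeriv.det {Q : ℂ → HC} {Q' : HC} (hQ : HasEntryDeriv Q Q') (h0 : Q 0 = 1) :
    HasDerivAt (fun t => (Q t).det) Q'.trace 0 := by
  simp only [Matrix.det_fin_two]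
  have := ((hQ 0 0).mul (hQ 1 1)).sub ((hQ 0 1).mul (hQ 1 0))
  refine this.congr_deriv ?_
  simp [h0, Matrix.trace_fin_two]

theorem HasEntryDeriv.mul_inv {P Q : ℂ → HC} {P' Q' : HC} (hP : HasEntryDeriv P P')
    (hQ : HasEntryDeriv Q Q') (h0 : Q 0 = 1) :
    HasEntryDeriv (fun t => P t * (Q t)⁻¹) (P' - P 0 * Q') := by
  have hd : HasDerivAt (fun t => ((Q t).det)⁻¹) (-Q'.trace) 0 := by
    exact ((hQ.det h0).inv (by simp [h0])).congr_deriv (by simp [h0])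
  have e : ∀ i j, (fun t => (P t * (Q t)⁻¹) i j) =
      fun t => ((Q t).det)⁻¹ * (P t i 0 * (Q t).adjugate 0 j + P t i 1 * (Q t).adjugate 1 j) := by
    intro i j
    funext t
    simp only [Matrix.inv_def, Ring.inverse_eq_inv', Matrix.mul_apply, Fin.sum_univ_two,
      Matrix.smul_apply, smul_eq_mul]
    ring
  intro i j
  rw [e]
  simp only [Matrix.adjugate_fin_two]
  fin_cases j
  · have := hd.mul (((hP i 0).mul (hQ 1 1)).add ((hP i 1).mul (hQ 1 0).neg))
    refine this.congr_deriv ?_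
    simp [h0, Matrix.trace_fin_two, Matrix.mul_apply, Fin.sum_univ_two]
    ring
  · have := hd.mul (((hP i 0).mul (hQ 0 1).neg).add ((hP i 1).mul (hQ 0 0)))
    refine this.congr_deriv ?_
    simp [h0, Matrix.trace_fin_two, Matrix.mul_apply, Fin.sum_univ_two]
    ring

theorem hasEntryDeriv_exp (X : gl2HC) (i j : Fin 2) :
    HasEntryDeriv (fun t => (expGL X t).val i j) (X i j) :=
  fun k l => exp_hasDerivAt X i j k l

theorem hasEntryDeriv_exp_inv (X : gl2HC) (i j : Fin 2) :
    HasEntryDeriv (fun t => ((expGL X t)⁻¹ : GL2HC).val i j) (-X i j) := by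
  intro k l
  have h : (fun t : ℂ => (((expGL X t)⁻¹ : GL2HC).val i j k l)) =
      fun t : ℂ => (NormedSpace.exp (t • (-X)) : gl2HC) i j k l := by
    funext t
    rw [smul_neg]
    rfl
  rw [h]
  exact exp_hasDerivAt (-X) i j k l

theorem expGL_zero (X : gl2HC) : expGL X 0 = 1 := by
  apply Units.ext
  change (NormedSpace.exp ((0:ℂ) • X) : gl2HC) = 1
  rw [zero_smul, NormedSpace.exp_zero]

/-- The curve `t ↦ (aZ+b)(cZ+d)⁻¹`, where `exp(tX)⁻¹ = (a b; c d)`. -/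
def flow (X : gl2HC) (Z : HC) (t : ℂ) : HC :=
  let g : gl2HC := ((expGL X t)⁻¹ : GL2HC).val
  (g 0 0 * Z + g 0 1) * (g 1 0 * Z + g 1 1)⁻¹

/-- The factor `1 / (N(cZ+d)^m N(a'-Zc'))` along `t ↦ exp(tX)`. -/
def factor (m : ℕ) (X : gl2HC) (Z : HC) (t : ℂ) : ℂ :=
  let g : gl2HC := ((expGL X t)⁻¹ : GL2HC).val
  let g' : gl2HC := (expGL X t).val
  ((g 1 0 * Z + g 1 1).det ^ m * (g' 0 0 - Z * g' 1 0).det)⁻¹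

theorem flow_zero (X : gl2HC) (Z : HC) : flow X Z 0 = Z := by
  simp [flow, expGL_zero]

theorem factor_zero (m : ℕ) (X : gl2HC) (Z : HC) : factor m X Z 0 = 1 := by
  simp [factor, expGL_zero]

theorem flow_deriv (X : gl2HC) (Z : HC) : HasEntryDeriv (flow X Z)
    (-(X 0 0 * Z) - X 0 1 + Z * X 1 0 * Z + Z * X 1 1) := by
  have hP := ((hasEntryDeriv_exp_inv X 0 0).mul_const Z).add (hasEntryDeriv_exp_inv X 0 1)
  have hQ := ((hasEntryDeriv_exp_inv X 1 0).mul_const Z).add (hasEntryDeriv_exp_inv X 1 1)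
  have := hP.mul_inv hQ (by simp [expGL_zero])
  intro i j
  refine (this i j).congr_deriv ?_
  refine congrFun (congrFun ?_ i) j
  simp [expGL_zero, mul_add, mul_assoc]
  abel

theorem factor_deriv (m : ℕ) (X : gl2HC) (Z : HC) : HasDerivAt (factor m X Z)
    (-(X 0 0).trace + m * (X 1 1).trace + (m + 1) * (X 1 0 * Z).trace) 0 := by
  have hQ := ((hasEntryDeriv_exp_inv X 1 0).mul_const Z).add (hasEntryDeriv_exp_inv X 1 1)
  have hR := (hasEntryDeriv_exp X 0 0).add ((hasEntryDeriv_exp X 1 0).const_mul (-Z))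
  have h1 := hQ.det (by simp [expGL_zero])
  have h2 := hR.det (by simp [expGL_zero])
  have h3 := ((h1.pow m).mul h2).inv (by simp [expGL_zero])
  have e : factor m X Z = fun t => ((((expGL X t)⁻¹ : GL2HC).val 1 0 * Z +
      ((expGL X t)⁻¹ : GL2HC).val 1 1).det ^ m *
      ((expGL X t).val 0 0 + (-Z) * (expGL X t).val 1 0).det)⁻¹ := by
    funext t
    simp [factor, sub_eq_add_neg]
  rw [e]
  refine h3.congr_deriv ?_
  simp [expGL_zero, Matrix.trace_mul_comm Z]
  ring

theorem ext0_apply (f : HCx → ℂ) (Z : HCx) : ext0 f Z.val = f Z :=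
  Function.Injective.extend_apply Units.val_injective _ _ _

theorem ext0_of_not_isUnit (f : HCx → ℂ) (Z : HC) (h : ¬ IsUnit Z) : ext0 f Z = 0 :=
  Function.extend_apply' _ _ _ (by rintro ⟨u, rfl⟩; exact h u.isUnit)

theorem varpiGroup_exp (m : ℕ) (X : gl2HC) (f : HCx → ℂ) (Z : HCx) (t : ℂ) :
    varpiGroup m (expGL X t) f Z = ext0 f (flow X Z.val t) * factor m X Z.val t :=
  rfl

theorem flow_eventually_isUnit (X : gl2HC) (Z : HCx) :
    ∀ᶠ t in nhds (0 : ℂ), IsUnit (flow X Z.val t) := by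
  have hc : ContinuousAt (fun t => (flow X Z.val t).det) 0 := by
    simp only [Matrix.det_fin_two]
    have h := flow_deriv X Z.val
    exact ((h 0 0).continuousAt.mul (h 1 1).continuousAt).sub
      ((h 0 1).continuousAt.mul (h 1 0).continuousAt)
  have h0 : (flow X Z.val 0).det ≠ 0 := by
    rw [flow_zero]
    exact ((Matrix.isUnit_iff_isUnit_det _).mp Z.isUnit).ne_zero
  filter_upwards [hc.eventually_ne h0] with t ht
  exact (Matrix.isUnit_iff_isUnit_det _).mpr (isUnit_iff_ne_zero.mpr ht)

/-- The coordinate functions as elements of `Zh`. -/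
def zc (i j : Fin 2) : Zh :=
  ⟨coord i j, Algebra.subset_adjoin (Or.inl ⟨(i, j), rfl⟩)⟩

/-- `N(Z)⁻¹` as an element of `Zh`. -/
def nInv : Zh := ⟨invN, Algebra.subset_adjoin (Or.inr rfl)⟩

/-- `N(Z)` as an element of `Zh`. -/
def nZ : Zh := zc 0 0 * zc 1 1 - zc 0 1 * zc 1 0

theorem nZ_apply (Z : HCx) : (nZ : HCx → ℂ) Z = Z.val.det := by
  rw [Matrix.det_fin_two]; rfl

theorem nZ_mul_nInv : nZ * nInv = 1 := by
  apply Subtype.ext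
  funext Z
  change (nZ : HCx → ℂ) Z * (Z.val.det)⁻¹ = 1
  rw [nZ_apply]
  exact mul_inv_cancel₀ ((Matrix.isUnit_iff_isUnit_det _).mp Z.isUnit).ne_zero

/-- The components of the vector field generated by `X`. -/
def vfield (X : gl2HC) (i j : Fin 2) : Zh :=
  -(∑ k, X 0 0 i k • zc k j) - algebraMap ℂ Zh (X 0 1 i j)
    + ∑ k, ∑ l, X 1 0 k l • (zc i k * zc l j) + ∑ k, X 1 1 k j • zc i k

theorem vfield_apply (X : gl2HC) (i j : Fin 2) (Z : HCx) :
    (vfield X i j : HCx → ℂ) Z =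
      (-(X 0 0 * Z.val) - X 0 1 + Z.val * X 1 0 * Z.val + Z.val * X 1 1) i j := by
  simp [vfield, Matrix.mul_apply, zc, coord, Fin.sum_univ_two]
  ring

/-- The derivative of the factor of automorphy in direction `X`. -/
def cocycle (m : ℕ) (X : gl2HC) : Zh :=
  algebraMap ℂ Zh (-(X 0 0).trace + m * (X 1 1).trace) +
    ∑ k, ∑ l, ((m + 1 : ℂ) * X 1 0 k l) • zc l k

theorem cocycle_apply (m : ℕ) (X : gl2HC) (Z : HCx) :
    (cocycle m X : HCx → ℂ) Z =
      -(X 0 0).trace + m * (X 1 1).trace + (m + 1) * (X 1 0 * Z.val).trace := by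
  simp [cocycle, Matrix.mul_apply, zc, coord, Fin.sum_univ_two, Matrix.trace_fin_two]
  ring

theorem exists_flow_deriv (X : gl2HC) (f : HCx → ℂ) (hf : f ∈ Zh) :
    ∃ g : Zh, ∀ Z : HCx,
      HasDerivAt (fun t => ext0 f (flow X Z.val t)) ((g : HCx → ℂ) Z) 0 := by
  induction hf using Algebra.adjoin_induction with
  | mem x hx =>
    rcases hx with ⟨⟨i, j⟩, rfl⟩ | rfl
    · refine ⟨vfield X i j, fun Z => ?_⟩
      rw [vfield_apply]
      refine (flow_deriv X Z.val i j).congr_of_eventuallyEq ?_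
      filter_upwards [flow_eventually_isUnit X Z] with t ht
      obtain ⟨u, hu⟩ := ht
      rw [← hu, ext0_apply]
      rfl
    · refine ⟨-(nInv ^ 2 * (vfield X 0 0 * zc 1 1 + zc 0 0 * vfield X 1 1
        - (vfield X 0 1 * zc 1 0 + zc 0 1 * vfield X 1 0))), fun Z => ?_⟩
      have hz : Z.val.det ≠ 0 := ((Matrix.isUnit_iff_isUnit_det _).mp Z.isUnit).ne_zero
      have h := flow_deriv X Z.val
      have hd := ((h 0 0).mul (h 1 1)).sub ((h 0 1).mul (h 1 0))
      have hd' := hd.inv (by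
        simp only [Pi.sub_apply, Pi.mul_apply, flow_zero]
        rw [← Matrix.det_fin_two]; exact hz)
      have hd'' : HasDerivAt (fun t => ((flow X Z.val t).det)⁻¹) _ 0 :=
        hd'.congr_of_eventuallyEq (Filter.Eventually.of_forall fun t => by
          simp [Matrix.det_fin_two])
      refine (hd''.congr_of_eventuallyEq ?_).congr_deriv ?_
      · filter_upwards [flow_eventually_isUnit X Z] with t ht
        obtain ⟨u, hu⟩ := ht
        rw [← hu, ext0_apply]
        rfl
      · simp only [Pi.sub_apply, Pi.mul_apply, flow_zero, ← vfield_apply]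
        rw [← Matrix.det_fin_two]
        have e : ((nInv : Zh) : HCx → ℂ) Z = (Z.val.det)⁻¹ := rfl
        simp only [NegMemClass.coe_neg, MulMemClass.coe_mul, SubmonoidClass.coe_pow,
          AddSubgroupClass.coe_sub, Subalgebra.coe_add, Pi.neg_apply, Pi.mul_apply, Pi.pow_apply,
          Pi.sub_apply, Pi.add_apply, e]
        simp only [zc, coord]
        field_simp
  | algebraMap r =>
    refine ⟨0, fun Z => ?_⟩
    refine (hasDerivAt_const (0 : ℂ) r).congr_of_eventuallyEq ?_
    filter_upwards [flow_eventually_isUnit X Z] with t ht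
    obtain ⟨u, hu⟩ := ht
    rw [← hu, ext0_apply]
    rfl
  | add f g _ _ hf hg =>
    obtain ⟨f', hf'⟩ := hf
    obtain ⟨g', hg'⟩ := hg
    refine ⟨f' + g', fun Z => ?_⟩
    refine ((hf' Z).add (hg' Z)).congr_of_eventuallyEq ?_
    filter_upwards [flow_eventually_isUnit X Z] with t ht
    obtain ⟨u, hu⟩ := ht
    simp only [Pi.add_apply, ← hu, ext0_apply]
  | mul f g _ _ hf hg =>
    obtain ⟨f', hf'⟩ := hf
    obtain ⟨g', hg'⟩ := hg
    refine ⟨f' * ⟨g, ‹_›⟩ + ⟨f, ‹_›⟩ * g', fun Z => ?_⟩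
    refine (((hf' Z).mul (hg' Z)).congr_of_eventuallyEq ?_).congr_deriv ?_
    · filter_upwards [flow_eventually_isUnit X Z] with t ht
      obtain ⟨u, hu⟩ := ht
      simp only [Pi.mul_apply, ← hu, ext0_apply]
    · rw [flow_zero, ext0_apply, ext0_apply]
      rfl

/-- The derivation of `Zh` given by the vector field generated by `X`. -/
def flowDeriv (X : gl2HC) : Derivation ℂ Zh Zh :=
  Derivation.mk'
    { toFun := fun f => Classical.choose (exists_flow_deriv X f f.2)
      map_add' := by
        intro f g
        apply Subtype.ext
        funext Z
        refine (Classical.choose_spec (exists_flow_deriv X _ (f + g).2) Z).unique ?_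
        refine ((Classical.choose_spec (exists_flow_deriv X _ f.2) Z).add
          (Classical.choose_spec (exists_flow_deriv X _ g.2) Z)).congr_of_eventuallyEq ?_
        filter_upwards [flow_eventually_isUnit X Z] with t ht
        obtain ⟨u, hu⟩ := ht
        simp only [Pi.add_apply, ← hu, ext0_apply, Subalgebra.coe_add]
      map_smul' := by
        intro c f
        apply Subtype.ext
        funext Z
        refine (Classical.choose_spec (exists_flow_deriv X _ (c • f).2) Z).unique ?_
        refine ((Classical.choose_spec (exists_flow_deriv X _ f.2) Z).const_mul
          c).congr_of_eventuallyEq ?_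
        filter_upwards [flow_eventually_isUnit X Z] with t ht
        obtain ⟨u, hu⟩ := ht
        simp only [← hu, ext0_apply, Subalgebra.coe_smul, Pi.smul_apply, smul_eq_mul] }
    (by
      intro f g
      apply Subtype.ext
      funext Z
      refine (Classical.choose_spec (exists_flow_deriv X _ (f * g).2) Z).unique ?_
      refine (((Classical.choose_spec (exists_flow_deriv X _ f.2) Z).mul
          (Classical.choose_spec (exists_flow_deriv X _ g.2) Z)).congr_of_eventuallyEq
            ?_).congr_deriv ?_
      · filter_upwards [flow_eventually_isUnit X Z] with t ht
        obtain ⟨u, hu⟩ := ht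
        simp only [Pi.mul_apply, ← hu, ext0_apply, MulMemClass.coe_mul]
      · rw [flow_zero, ext0_apply, ext0_apply]
        simp only [LinearMap.coe_mk, AddHom.coe_mk, smul_eq_mul, Subalgebra.coe_add,
          MulMemClass.coe_mul, Pi.add_apply, Pi.mul_apply]
        ring)

theorem flowDeriv_spec (X : gl2HC) (f : Zh) (Z : HCx) :
    HasDerivAt (fun t => ext0 f (flow X Z.val t)) ((flowDeriv X f : HCx → ℂ) Z) 0 :=
  Classical.choose_spec (exists_flow_deriv X f f.2) Z

theorem flowDeriv_zc (X : gl2HC) (i j : Fin 2) : flowDeriv X (zc i j) = vfield X i j := by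
  apply Subtype.ext
  funext Z
  refine (flowDeriv_spec X (zc i j) Z).unique ?_
  rw [vfield_apply]
  refine (flow_deriv X Z.val i j).congr_of_eventuallyEq ?_
  filter_upwards [flow_eventually_isUnit X Z] with t ht
  obtain ⟨u, hu⟩ := ht
  rw [← hu, ext0_apply]
  rfl

theorem derivation_ext {D D' : Derivation ℂ Zh Zh} (h : ∀ i j, D (zc i j) = D' (zc i j)) :
    D = D' := by
  have hN : D nZ = D' nZ := by
    simp only [nZ, map_sub, Derivation.leibniz, h]
  refine Derivation.ext_of_adjoin_eq_top _ (Algebra.adjoin_adjoin_coe_preimage (R := ℂ)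
    (s := Set.range (fun p : Fin 2 × Fin 2 => coord p.1 p.2) ∪ {invN})) ?_
  rintro ⟨x, hx⟩ (⟨⟨i, j⟩, hij⟩ | hi)
  · have : (⟨x, hx⟩ : Zh) = zc i j := Subtype.ext hij.symm
    exact this ▸ h i j
  · have : (⟨x, hx⟩ : Zh) = nInv := Subtype.ext hi
    have h1 : nInv * nZ = 1 := by rw [mul_comm]; exact nZ_mul_nInv
    have h2 : D nInv = D' nInv := by
      rw [D.leibniz_of_mul_eq_one h1, D'.leibniz_of_mul_eq_one h1, hN]
    exact this ▸ h2

theorem varpiFun_hasDerivAt (m : ℕ) (X : gl2HC) (f : Zh) (Z : HCx) :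
    HasDerivAt (fun t => varpiGroup m (expGL X t) f Z)
      (((flowDeriv X f + cocycle m X * f : Zh) : HCx → ℂ) Z) 0 := by
  refine ((flowDeriv_spec X f Z).mul (factor_deriv m X Z.val)).congr_deriv ?_
  rw [flow_zero, factor_zero, ext0_apply, ← cocycle_apply]
  simp only [Subalgebra.coe_add, MulMemClass.coe_mul, Pi.add_apply, Pi.mul_apply]
  ring

theorem varpiFun_eq (m : ℕ) (X : gl2HC) (f : Zh) :
    varpiFun m X f = ((flowDeriv X f + cocycle m X * f : Zh) : HCx → ℂ) :=
  funext fun Z => (varpiFun_hasDerivAt m X f Z).deriv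

theorem varpiFun_mem (m : ℕ) (X : gl2HC) (f : Zh) : varpiFun m X f ∈ Zh := by
  rw [varpiFun_eq]
  exact Subtype.property _

/-- The differentiated action `ϖ_m` of `gl(2, HC)` on `Zh`. -/
def varpi (m : ℕ) (X : gl2HC) (f : Zh) : Zh := ⟨varpiFun m X f, varpiFun_mem m X f⟩

theorem varpi_eq (m : ℕ) (X : gl2HC) (f : Zh) : varpi m X f = flowDeriv X f + cocycle m X * f :=
  Subtype.ext (varpiFun_eq m X f)

theorem flowDeriv_add (X Y : gl2HC) : flowDeriv (X + Y) = flowDeriv X + flowDeriv Y := by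
  apply derivation_ext
  intro i j
  rw [Derivation.add_apply, flowDeriv_zc, flowDeriv_zc, flowDeriv_zc]
  apply Subtype.ext
  funext Z
  rw [Subalgebra.coe_add, Pi.add_apply]
  simp only [vfield_apply]
  simp [add_mul, mul_add, Matrix.add_apply]
  ring

theorem flowDeriv_smul (c : ℂ) (X : gl2HC) : flowDeriv (c • X) = c • flowDeriv X := by
  apply derivation_ext
  intro i j
  rw [Derivation.smul_apply, flowDeriv_zc, flowDeriv_zc]
  apply Subtype.ext
  funext Z
  rw [Subalgebra.coe_smul, Pi.smul_apply]
  simp only [vfield_apply]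
  simp [Matrix.smul_apply]
  ring

theorem flowDeriv_vfield (X Y : gl2HC) (i j : Fin 2) (Z : HCx) (V : HC)
    (hV : ∀ k l, V k l = (vfield X k l : HCx → ℂ) Z) :
    (flowDeriv X (vfield Y i j) : HCx → ℂ) Z =
      (-(Y 0 0 * V) + V * Y 1 0 * Z.val + Z.val * Y 1 0 * V + V * Y 1 1) i j := by
  rw [vfield]
  simp only [flowDeriv_zc, Fin.sum_univ_two, map_add, map_sub, map_neg,
    Derivation.map_algebraMap, Derivation.leibniz, Derivation.map_smul]
  simp [Matrix.mul_apply, Fin.sum_univ_two, hV, zc, coord]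
  ring

theorem flowDeriv_lie (X Y : gl2HC) : flowDeriv ⁅X, Y⁆ = ⁅flowDeriv X, flowDeriv Y⁆ := by
  apply derivation_ext
  intro i j
  rw [Derivation.commutator_apply, flowDeriv_zc, flowDeriv_zc, flowDeriv_zc]
  apply Subtype.ext
  funext Z
  rw [AddSubgroupClass.coe_sub, Pi.sub_apply, flowDeriv_vfield X Y i j Z _ (fun k l =>
    (vfield_apply X k l Z).symm), flowDeriv_vfield Y X i j Z _ (fun k l =>
    (vfield_apply Y k l Z).symm), vfield_apply, ← Matrix.sub_apply]
  refine congrFun (congrFun ?_ i) j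
  simp only [LieRing.of_associative_ring_bracket, Matrix.sub_apply,
    Matrix.mul_apply (n := Fin 2) (α := HC), Fin.sum_univ_two]
  noncomm_ring

theorem flowDeriv_cocycle (m : ℕ) (X Y : gl2HC) (Z : HCx) (V : HC)
    (hV : ∀ k l, V k l = (vfield X k l : HCx → ℂ) Z) :
    (flowDeriv X (cocycle m Y) : HCx → ℂ) Z = (m + 1) * (Y 1 0 * V).trace := by
  rw [cocycle]
  simp only [flowDeriv_zc, Fin.sum_univ_two, map_add,
    Derivation.map_algebraMap, Derivation.map_smul]
  simp [Matrix.mul_apply, Fin.sum_univ_two, hV, Matrix.trace_fin_two]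
  ring

theorem cocycle_lie (m : ℕ) (X Y : gl2HC) :
    cocycle m ⁅X, Y⁆ = flowDeriv X (cocycle m Y) - flowDeriv Y (cocycle m X) := by
  apply Subtype.ext
  funext Z
  rw [AddSubgroupClass.coe_sub, Pi.sub_apply, flowDeriv_cocycle m X Y Z _ (fun k l =>
    (vfield_apply X k l Z).symm), flowDeriv_cocycle m Y X Z _ (fun k l =>
    (vfield_apply Y k l Z).symm), cocycle_apply]
  simp only [LieRing.of_associative_ring_bracket, Matrix.sub_apply,
    Matrix.mul_apply (n := Fin 2) (α := HC), Fin.sum_univ_two]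
  simp only [Matrix.trace_fin_two, Matrix.mul_apply, Matrix.add_apply, Matrix.sub_apply,
    Matrix.neg_apply, Fin.sum_univ_two]
  ring

/-- `Zh` as a module over `gl(2, HC)` through `ϖ_2`. -/
instance instLieRingModuleZh : LieRingModule gl2HC Zh where
  bracket X f := varpi 2 X f
  add_lie X Y f := by
    change varpi 2 (X + Y) f = varpi 2 X f + varpi 2 Y f
    have : cocycle 2 (X + Y) = cocycle 2 X + cocycle 2 Y := by
      apply Subtype.ext
      funext Z
      rw [Subalgebra.coe_add, Pi.add_apply]
      simp only [cocycle_apply]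
      simp [add_mul]
      ring
    simp only [varpi_eq, flowDeriv_add, Derivation.add_apply, this]
    ring
  lie_add X f g := by
    change varpi 2 X (f + g) = varpi 2 X f + varpi 2 X g
    simp only [varpi_eq, map_add]
    ring
  leibniz_lie X Y f := by
    change varpi 2 X (varpi 2 Y f) = varpi 2 ⁅X, Y⁆ f + varpi 2 Y (varpi 2 X f)
    simp only [varpi_eq, flowDeriv_lie, cocycle_lie, Derivation.commutator_apply, map_add,
      Derivation.leibniz, smul_eq_mul]
    ring

theorem lie_Zh_def (X : gl2HC) (f : Zh) : ⁅X, f⁆ = varpi 2 X f := rfl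

instance instLieModuleZh : LieModule ℂ gl2HC Zh where
  smul_lie c X f := by
    have : cocycle 2 (c • X) = c • cocycle 2 X := by
      apply Subtype.ext
      funext Z
      rw [Subalgebra.coe_smul, Pi.smul_apply]
      simp only [cocycle_apply]
      simp [Matrix.smul_apply]
      ring
    simp only [lie_Zh_def, varpi_eq, flowDeriv_smul, Derivation.smul_apply, this, smul_add,
      smul_mul_assoc]
  lie_smul c X f := by
    simp only [lie_Zh_def, varpi_eq, Derivation.map_smul, smul_add, mul_smul_comm]

/-! ### Matrix coefficients and their spans -/

/-- The matrix coefficient `t^l_{n m}` with `p = 2l`, `i = l - m`, `j = l - n`: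
`(2πi)⁻¹ ∮ (s z₁₁ + z₂₁)^(l-m) (s z₁₂ + z₂₂)^(l+m) s^(-l+n) ds/s`. -/
def tCoeff (p i j : ℕ) (Z : HC) : ℂ :=
  (2 * Real.pi * I)⁻¹ * ∮ s in C(0, 1),
    (s * Z 0 0 + Z 1 0) ^ i * (s * Z 0 1 + Z 1 1) ^ (p - i) * s ^ (-(j : ℤ)) / s

/-- The matrix coefficient as an element of `Zh`. -/
def tPoly (p i j : ℕ) : Zh :=
  (((Polynomial.X * Polynomial.C (zc 0 0) + Polynomial.C (zc 1 0)) ^ i *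
    (Polynomial.X * Polynomial.C (zc 0 1) + Polynomial.C (zc 1 1)) ^ (p - i)).coeff j)

theorem circleIntegral_coeff (q : Polynomial ℂ) (j : ℕ) :
    (2 * Real.pi * I)⁻¹ * (∮ s in C(0, 1), q.eval s * s ^ (-(j : ℤ)) / s) = q.coeff j := by
  have hc : ∀ n : ℤ, CircleIntegrable (fun s : ℂ => s ^ n) 0 1 := by
    intro n
    refine ContinuousOn.circleIntegrable zero_le_one ?_
    refine continuousOn_id.zpow₀ n fun s hs => Or.inl ?_
    rintro rfl
    simp at hs
  have h1 : (∮ s in C(0, 1), q.eval s * s ^ (-(j : ℤ)) / s) =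
      ∮ s in C(0, 1), ∑ n ∈ q.support, q.coeff n * s ^ ((n : ℤ) - j - 1) := by
    refine circleIntegral.integral_congr zero_le_one fun s hs => ?_
    have hs0 : s ≠ 0 := by
      rintro rfl
      simp at hs
    simp only [Polynomial.eval_eq_sum, Polynomial.sum, Finset.sum_mul, Finset.sum_div]
    refine Finset.sum_congr rfl fun n _ => ?_
    rw [zpow_sub_one₀ hs0, zpow_sub₀ hs0, _root_.zpow_neg, zpow_natCast, zpow_natCast]
    field_simp
  have h2 : ∀ n : ℕ, (∮ s in C(0, 1), q.coeff n * s ^ ((n : ℤ) - j - 1)) =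
      if n = j then q.coeff n * (2 * Real.pi * I) else 0 := by
    intro n
    rw [circleIntegral.integral_const_mul]
    split_ifs with h
    · subst h
      have := circleIntegral.integral_sub_center_inv (0 : ℂ) (R := 1) one_ne_zero
      simp only [sub_zero] at this
      simp [this]
    · have := circleIntegral.integral_sub_zpow_of_ne (n := (n : ℤ) - j - 1) (by omega) 0 0 1
      simp only [sub_zero] at this
      rw [this, mul_zero]
  rw [h1, circleIntegral.integral_fun_sum]
  · simp only [h2, Finset.sum_ite_eq']
    have hpi : (2 * Real.pi * I : ℂ) ≠ 0 := Complex.two_pi_I_ne_zero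
    split_ifs with h
    · field_simp
    · rw [Polynomial.notMem_support_iff.mp h, mul_zero]
  · intro n _
    exact (hc _).const_fun_smul (a := q.coeff n)

/-- Evaluation of the elements of `Zh` at a point. -/
def evalZh (Z : HCx) : Zh →+* ℂ := (Pi.evalRingHom (fun _ : HCx => ℂ) Z).comp Zh.val.toRingHom

theorem tPoly_apply (p i j : ℕ) (Z : HCx) : (tPoly p i j : HCx → ℂ) Z = tCoeff p i j Z.val := by
  change evalZh Z (tPoly p i j) = _
  rw [tPoly, ← Polynomial.coeff_map, ← circleIntegral_coeff]
  simp only [Polynomial.map_mul, Polynomial.map_pow, Polynomial.map_add, Polynomial.map_X,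
    Polynomial.map_C, Polynomial.eval_mul, Polynomial.eval_pow, Polynomial.eval_add,
    Polynomial.eval_X, Polynomial.eval_C]
  rfl

/-- The function `t^l_{n m}(Z) N(Z)^k`, with `p = 2l`, `i = l - m`, `j = l - n`. -/
def tNFun (p i j : ℕ) (k : ℤ) : HCx → ℂ := fun Z => tCoeff p i j Z.val * Z.val.det ^ k

theorem tNFun_mem (p i j : ℕ) (k : ℤ) : tNFun p i j k ∈ Zh := by
  obtain ⟨n, rfl | rfl⟩ := k.eq_nat_or_neg
  · have : tNFun p i j n = ((tPoly p i j * nZ ^ n : Zh) : HCx → ℂ) := by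
      funext Z
      simp [tNFun, tPoly_apply, nZ_apply]
    exact this ▸ Subtype.property _
  · have : tNFun p i j (-n) = ((tPoly p i j * nInv ^ n : Zh) : HCx → ℂ) := by
      funext Z
      simp [tNFun, tPoly_apply, nInv, invN]
    exact this ▸ Subtype.property _

/-- `t^l_{n m}(Z) N(Z)^k` as an element of `Zh`, with `p = 2l`, `i = l - m`, `j = l - n`. -/
def tN (p i j : ℕ) (k : ℤ) : Zh := ⟨tNFun p i j k, tNFun_mem p i j k⟩

/-- The `ℂ`-span of the `t^l_{n m}(Z) N(Z)^k` with `l = 0, 1/2, 1, …`, `m, n = -l, …, l` and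
`k ∈ ℤ` subject to the condition `R (2l) k`. -/
def spanTN (R : ℤ → ℤ → Prop) : Submodule ℂ Zh :=
  Submodule.span ℂ {f | ∃ (p i j : ℕ) (k : ℤ), i ≤ p ∧ j ≤ p ∧ R p k ∧ f = tN p i j k}

/-! ### Subquotients and composition series -/

/-- The subquotient `V / W` of `Zh` for invariant subspaces `W ≤ V`. -/
abbrev SubQuot (V W : LieSubmodule ℂ gl2HC Zh) : Type := V ⧸ LieSubmodule.comap V.incl W

/-- A finite chain of invariant subspaces `0 = c 0 ⊆ c 1 ⊆ … ⊆ c n = Zh` whose successive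
quotients are irreducible. -/
def IsCompositionSeries (n : ℕ) (c : Fin (n + 1) → LieSubmodule ℂ gl2HC Zh) : Prop :=
  c 0 = ⊥ ∧ c (Fin.last n) = ⊤ ∧ ∀ i : Fin n, c i.castSucc ≤ c i.succ ∧
    LieModule.IsIrreducible ℂ gl2HC (SubQuot (c i.succ) (c i.castSucc))

end

end Quat

open Quat

/-!
The algebra `Zh` decomposes without multiplicities under `gl(2) × gl(2)`, the diagonal blocks of
`gl(2, HC)`: its irreducible constituents are the spaces `V(p, k)` spanned by the `(p + 1) ^ 2`
functions `t^l_{n m} N^k` with `p = 2l`. That these functions span `Zh` is a consequence of the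
two-term expansion of `z_{ij} t^l_{n m}` in `t^{l+1/2}` and `N t^{l-1/2}` (`entry01_mul_matCoeff` and
its companions). Three elements of the torus and one product of a raising and a lowering operator
are diagonal on them and separate them (`exists_diagEig_ne`), whence they are linearly independent,
and every invariant subspace is spanned by those of them that it contains
(`toZh_mem_of_repr_ne_zero`).

The off-diagonal blocks connect the `V(p, k)`. A translation maps `V(p, k)` to
`V(p - 1, k) + V(p + 1, k - 1)` with coefficients proportional to `p + k + 1` and `k`, and a quadratic
vector field maps it to `V(p + 1, k) + V(p - 1, k + 1)` with coefficients proportional to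
`p + k + 3` and `k + 2` (`lie_block01_tFun`, `lie_block10_tFun`). So the invariant subspaces correspond
to the sets of pairs `(p, k)` that are closed under the transitions with nonzero coefficient. The
directed graph of these transitions has five strongly connected components, the *strata*
`k ≥ 0`; `p + k ≤ -3`; `k ≤ -2` and `p + k ≥ -1`; `k = -1`; and `p + k = -2`. The first three are
closed and give `Zh⁺`, `Zh₂⁻` and `J₂`. The stratum `k = -1` generates `I₂⁺`, which also contains
the strata of `Zh⁺` and `J₂`; the stratum `p + k = -2` generates `I₂⁻`, which also contains the
strata of `Zh₂⁻` and `J₂`. An invariant subspace is thus determined by the strata that it contains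
(`le_iff_hasStratum`), and all statements about the lattice become statements about subsets of a
five-element set.

An irreducible subquotient `V / W` contains exactly one stratum `r`. The subspace generated by `r`
surjects onto `V / W`, and Schur's lemma identifies `V / W` with the irreducible quotient of that
subspace (`nonempty_subQuot_equiv`). Since every stratum appears in exactly one step of a
composition series, this determines the factors.

`Zh⁺` is the span of the `V(p, k)` with `k ≥ 0` because that span contains `1` and is stable under
multiplication by the coordinates. For `Zh₂⁻` the substitution `Z ↦ Z⁻¹` gives the inclusion of the
span, and the other inclusion holds because the span contains `N^{-3}` and is stable under
multiplication by the entries of `Z⁻¹`.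
-/

namespace Quat

open Polynomial

noncomputable section

/-! ### Ladder relations for matrix coefficients -/

section MatrixCoefficients

variable {R : Type*} [CommRing R]

/-- The coefficient of `X ^ j` for an integer exponent `j`, which is `0` for negative `j`. Integer
exponents make the ladder relations below hold without boundary cases in `j`. -/
def zcoeff (j : ℤ) (q : R[X]) : R := if 0 ≤ j then q.coeff j.toNat else 0

theorem zcoeff_natCast (j : ℕ) (q : R[X]) : zcoeff (j : ℤ) q = q.coeff j := by
  simp [zcoeff]

theorem zcoeff_of_neg {j : ℤ} (h : j < 0) (q : R[X]) : zcoeff j q = 0 := by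
  simp [zcoeff, not_le.mpr h]

theorem zcoeff_add (j : ℤ) (p q : R[X]) : zcoeff j (p + q) = zcoeff j p + zcoeff j q := by
  unfold zcoeff; split_ifs <;> simp

theorem zcoeff_sub (j : ℤ) (p q : R[X]) : zcoeff j (p - q) = zcoeff j p - zcoeff j q := by
  unfold zcoeff; split_ifs <;> simp

theorem zcoeff_neg (j : ℤ) (p : R[X]) : zcoeff j (-p) = -zcoeff j p := by
  unfold zcoeff; split_ifs <;> simp

theorem zcoeff_C_mul (j : ℤ) (r : R) (p : R[X]) : zcoeff j (C r * p) = r * zcoeff j p := by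
  unfold zcoeff; split_ifs <;> simp

theorem zcoeff_natCast_mul (j : ℤ) (r : ℕ) (p : R[X]) :
    zcoeff j ((r : R[X]) * p) = r * zcoeff j p := by
  rw [← C_eq_natCast, zcoeff_C_mul]

theorem zcoeff_X_mul (j : ℤ) (p : R[X]) : zcoeff j (X * p) = zcoeff (j - 1) p := by
  unfold zcoeff
  rcases lt_trichotomy j 0 with h | h | h
  · rw [if_neg (by omega), if_neg (by omega)]
  · subst h; simp
  · obtain ⟨m, rfl⟩ : ∃ m : ℕ, j = m + 1 := ⟨(j - 1).toNat, by omega⟩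
    rw [if_pos (by omega), if_pos (by omega), show ((m : ℤ) + 1).toNat = m + 1 by omega,
      show ((m : ℤ) + 1 - 1).toNat = m by omega, coeff_X_mul]

theorem zcoeff_derivative (j : ℤ) (p : R[X]) :
    zcoeff j (derivative p) = (j + 1 : ℤ) * zcoeff (j + 1) p := by
  unfold zcoeff
  rcases lt_trichotomy j (-1) with h | h | h
  · rw [if_neg (by omega), if_neg (by omega), mul_zero]
  · subst h; simp
  · obtain ⟨m, rfl⟩ : ∃ m : ℕ, j = m := ⟨j.toNat, by omega⟩
    rw [if_pos (by omega), if_pos (by omega), show ((m : ℤ) + 1).toNat = m + 1 by omega,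
      Int.toNat_natCast, coeff_derivative]
    push_cast
    ring

variable (z : Matrix (Fin 2) (Fin 2) R) (n : Rˣ)

/-- The entry `c` of the row vector `(s, 1) * z`, as a polynomial in `s`. -/
def rowPoly (c : Fin 2) : R[X] := X * C (z 0 c) + C (z 1 c)

/-- The coefficient of `s ^ j` in `(s z₁₁ + z₂₁) ^ a (s z₁₂ + z₂₂) ^ b`, multiplied by `n ^ k`. In
the application `n` is the determinant of `z`, so that this is `t^l_{n m}(z) N(z) ^ k` with
`2l = a + b`. -/
def matCoeff (a b : ℕ) (j k : ℤ) : R :=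
  zcoeff j (rowPoly z 0 ^ a * rowPoly z 1 ^ b) * ((n ^ k : Rˣ) : R)

theorem natDegree_rowPoly_le (c : Fin 2) : (rowPoly z c).natDegree ≤ 1 := by
  unfold rowPoly
  compute_degree

theorem matCoeff_of_neg (a b : ℕ) {j : ℤ} (k : ℤ) (h : j < 0) : matCoeff z n a b j k = 0 := by
  rw [matCoeff, zcoeff_of_neg h, zero_mul]

theorem matCoeff_of_lt (a b : ℕ) {j : ℤ} (k : ℤ) (h : (a + b : ℤ) < j) :
    matCoeff z n a b j k = 0 := by
  lift j to ℕ using by omega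
  rw [matCoeff, zcoeff_natCast, coeff_eq_zero_of_natDegree_lt, zero_mul]
  calc _ ≤ a * 1 + b * 1 := natDegree_mul_le_of_le
        (natDegree_pow_le_of_le a (natDegree_rowPoly_le z 0))
        (natDegree_pow_le_of_le b (natDegree_rowPoly_le z 1))
    _ < j := by omega

theorem matCoeff_mul_unit_zpow (a b : ℕ) (j k m : ℤ) :
    matCoeff z n a b j k * ((n ^ m : Rˣ) : R) = matCoeff z n a b j (k + m) := by
  rw [matCoeff, matCoeff, mul_assoc, ← Units.val_mul, zpow_add]

/-- Multiplying `matCoeff z n a b j k` by an entry of `z` is a two-term (Clebsch–Gordan) expansion.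
It follows by comparing the derivative in `s` of the generating product with the relation
`z₁₁ (s z₁₂ + z₂₂) - z₁₂ (s z₁₁ + z₂₁) = det z`. -/
theorem entry01_mul_matCoeff (hn : (n : R) = z.det) (a b : ℕ) (j k : ℤ) :
    (a + b + 1 : ℕ) * (z 0 1 * matCoeff z n a b j k) =
      (j + 1 : ℤ) * matCoeff z n a (b + 1) (j + 1) k -
        a * matCoeff z n (a - 1) b j (k + 1) := by
  have key : C (z 0 1) * (((a + b + 1 : ℕ) : R[X]) * (rowPoly z 0 ^ a * rowPoly z 1 ^ b)) =
      derivative (rowPoly z 0 ^ a * rowPoly z 1 ^ (b + 1)) -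
        a * (C z.det * (rowPoly z 0 ^ (a - 1) * rowPoly z 1 ^ b)) := by
    have hA : (a : R[X]) * rowPoly z 0 ^ a = a * rowPoly z 0 ^ (a - 1) * rowPoly z 0 := by
      rcases a with _ | a
      · simp
      · rw [Nat.add_sub_cancel, pow_succ]; ring
    have d0 : ∀ c, derivative (rowPoly z c) = C (z 0 c) := by intro c; simp [rowPoly]
    have hdet : C z.det = C (z 0 0) * rowPoly z 1 - C (z 0 1) * rowPoly z 0 := by
      simp only [rowPoly, Matrix.det_fin_two, map_sub, map_mul]; ring
    rw [derivative_mul, derivative_pow, derivative_pow, d0, d0, hdet, Nat.add_sub_cancel]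
    simp only [C_eq_natCast]
    push_cast
    linear_combination (C (z 0 1) * rowPoly z 1 ^ b) * hA
  have h := congrArg (fun q => zcoeff j q * ((n ^ k : Rˣ) : R)) key
  simp only [zcoeff_sub, zcoeff_C_mul, zcoeff_natCast_mul, zcoeff_derivative] at h
  simp only [matCoeff, zpow_add_one, Units.val_mul, hn]
  linear_combination h

theorem matCoeff_succ_right (a b : ℕ) (j k : ℤ) :
    matCoeff z n a (b + 1) j k =
      z 0 1 * matCoeff z n a b (j - 1) k + z 1 1 * matCoeff z n a b j k := by
  have key : rowPoly z 0 ^ a * rowPoly z 1 ^ (b + 1) =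
      C (z 0 1) * (X * (rowPoly z 0 ^ a * rowPoly z 1 ^ b)) +
        C (z 1 1) * (rowPoly z 0 ^ a * rowPoly z 1 ^ b) := by
    rw [pow_succ, rowPoly, rowPoly]; ring
  rw [matCoeff, key, zcoeff_add, zcoeff_C_mul, zcoeff_C_mul, zcoeff_X_mul, matCoeff, matCoeff]
  ring

theorem matCoeff_succ_left (a b : ℕ) (j k : ℤ) :
    matCoeff z n (a + 1) b j k =
      z 0 0 * matCoeff z n a b (j - 1) k + z 1 0 * matCoeff z n a b j k := by
  have key : rowPoly z 0 ^ (a + 1) * rowPoly z 1 ^ b =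
      C (z 0 0) * (X * (rowPoly z 0 ^ a * rowPoly z 1 ^ b)) +
        C (z 1 0) * (rowPoly z 0 ^ a * rowPoly z 1 ^ b) := by
    rw [pow_succ, rowPoly, rowPoly]; ring
  rw [matCoeff, key, zcoeff_add, zcoeff_C_mul, zcoeff_C_mul, zcoeff_X_mul, matCoeff, matCoeff]
  ring

theorem entry11_mul_matCoeff (hn : (n : R) = z.det) (a b : ℕ) (j k : ℤ) :
    (a + b + 1 : ℕ) * (z 1 1 * matCoeff z n a b j k) =
      (a + b + 1 - j : ℤ) * matCoeff z n a (b + 1) j k +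
        a * matCoeff z n (a - 1) b (j - 1) (k + 1) := by
  have h1 := entry01_mul_matCoeff z n hn a b (j - 1) k
  have h2 := matCoeff_succ_right z n a b j k
  rw [sub_add_cancel] at h1
  push_cast at h1 ⊢
  linear_combination -h1 - (a + b + 1 : R) * h2

theorem entry00_mul_matCoeff (hn : (n : R) = z.det) (a b : ℕ) (j k : ℤ) :
    (a + b + 1 : ℕ) * (z 0 0 * matCoeff z n a b j k) =
      (j + 1 : ℤ) * matCoeff z n (a + 1) b (j + 1) k +
        b * matCoeff z n a (b - 1) j (k + 1) := by
  have key : C (z 0 0) * (((a + b + 1 : ℕ) : R[X]) * (rowPoly z 0 ^ a * rowPoly z 1 ^ b)) =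
      derivative (rowPoly z 0 ^ (a + 1) * rowPoly z 1 ^ b) +
        b * (C z.det * (rowPoly z 0 ^ a * rowPoly z 1 ^ (b - 1))) := by
    have hB : (b : R[X]) * rowPoly z 1 ^ b = b * rowPoly z 1 ^ (b - 1) * rowPoly z 1 := by
      rcases b with _ | b
      · simp
      · rw [Nat.add_sub_cancel, pow_succ]; ring
    have d0 : ∀ c, derivative (rowPoly z c) = C (z 0 c) := by intro c; simp [rowPoly]
    have hdet : C z.det = C (z 0 0) * rowPoly z 1 - C (z 0 1) * rowPoly z 0 := by
      simp only [rowPoly, Matrix.det_fin_two, map_sub, map_mul]; ring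
    rw [derivative_mul, derivative_pow, derivative_pow, d0, d0, hdet, Nat.add_sub_cancel]
    simp only [C_eq_natCast]
    push_cast
    linear_combination (C (z 0 0) * rowPoly z 0 ^ a) * hB
  have h := congrArg (fun q => zcoeff j q * ((n ^ k : Rˣ) : R)) key
  simp only [zcoeff_add, zcoeff_C_mul, zcoeff_natCast_mul, zcoeff_derivative] at h
  simp only [matCoeff, zpow_add_one, Units.val_mul, hn]
  linear_combination h

theorem entry10_mul_matCoeff (hn : (n : R) = z.det) (a b : ℕ) (j k : ℤ) :
    (a + b + 1 : ℕ) * (z 1 0 * matCoeff z n a b j k) =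
      (a + b + 1 - j : ℤ) * matCoeff z n (a + 1) b j k -
        b * matCoeff z n a (b - 1) (j - 1) (k + 1) := by
  have h1 := entry00_mul_matCoeff z n hn a b (j - 1) k
  have h2 := matCoeff_succ_left z n a b j k
  rw [sub_add_cancel] at h1
  push_cast at h1 ⊢
  linear_combination -h1 - (a + b + 1 : R) * h2

variable (D : Derivation ℤ R R)

theorem derivation_unit_zpow (k : ℤ) :
    D ((n ^ k : Rˣ) : R) = k * ((n ^ (k - 1) : Rˣ) : R) * D n := by
  have hinv : D ((n⁻¹ : Rˣ) : R) = -((n⁻¹ : Rˣ) : R) ^ 2 * D n := by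
    rw [D.leibniz_of_mul_eq_one (a := ((n⁻¹ : Rˣ) : R)) (b := (n : R)) (by simp), smul_eq_mul]
  induction k using Int.induction_on with
  | zero => simp
  | succ i ih =>
    rw [zpow_add_one, Units.val_mul, D.leibniz, ih, add_sub_cancel_right]
    have : ((n ^ (i : ℤ) : Rˣ) : R) = ((n ^ ((i : ℤ) - 1) : Rˣ) : R) * n := by
      rw [← Units.val_mul, ← zpow_add_one, sub_add_cancel]
    rw [this]
    simp only [smul_eq_mul]
    push_cast
    ring
  | pred i ih =>
    rw [zpow_sub_one (n := -(i : ℤ)), Units.val_mul, D.leibniz, ih, hinv, zpow_sub_one,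
      zpow_sub_one, zpow_sub_one]
    simp only [smul_eq_mul, Units.val_mul]
    push_cast
    ring

/-- The Leibniz rule for `matCoeff`. The derivation is extended to `R[X]` coefficientwise. -/
theorem derivation_matCoeff (a b : ℕ) (j k : ℤ) :
    D (matCoeff z n a b j k) =
      (zcoeff j ((a : R[X]) * (rowPoly z 0 ^ (a - 1) * rowPoly z 1 ^ b) *
            (X * C (D (z 0 0)) + C (D (z 1 0))) +
          (b : R[X]) * (rowPoly z 0 ^ a * rowPoly z 1 ^ (b - 1)) *
            (X * C (D (z 0 1)) + C (D (z 1 1)))) * ((n ^ k : Rˣ) : R) +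
        k * matCoeff z n a b j (k - 1) * D n) := by
  let _ : Differential R := ⟨D⟩
  have hz : ∀ q : R[X], D (zcoeff j q) = zcoeff j (Differential.mapCoeffs q) := by
    intro q
    unfold zcoeff
    split_ifs
    · rw [Differential.coeff_mapCoeffs]; rfl
    · simp
  have hrow : ∀ c, Differential.mapCoeffs (rowPoly z c) = X * C (D (z 0 c)) + C (D (z 1 c)) := by
    intro c
    rw [rowPoly, map_add, Derivation.leibniz, Differential.mapCoeffs_X,
      Differential.mapCoeffs_C, Differential.mapCoeffs_C, smul_zero, add_zero, smul_eq_mul]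
    rfl
  rw [matCoeff, D.leibniz, hz, derivation_unit_zpow, Derivation.leibniz, Derivation.leibniz_pow,
    Derivation.leibniz_pow, hrow, hrow, matCoeff]
  simp only [smul_eq_mul, nsmul_eq_mul]
  rw [show ∀ u v x y p q : R[X], u * (b * (v * y)) + p * (a * (q * x)) =
    a * (q * p) * x + b * (u * v) * y by intros; ring]
  ring

end MatrixCoefficients

/-! ### Derivations of matrix coefficients -/

section BlockFormulas

variable {R : Type*} [CommRing R] (z : Matrix (Fin 2) (Fin 2) R) (n : Rˣ)
  (D : Derivation ℤ R R) (a b : ℕ) (j k : ℤ)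

theorem natCast_mul_pow_pred {S : Type*} [CommRing S] (x : S) (a : ℕ) :
    (a : S) * x ^ a = a * x ^ (a - 1) * x := by
  rcases a with _ | a
  · simp
  · rw [Nat.add_sub_cancel, pow_succ]; ring

theorem derivation_det {D : Derivation ℤ R R} (hn : (n : R) = z.det) :
    D n = D (z 0 0) * z 1 1 + z 0 0 * D (z 1 1) - (D (z 0 1) * z 1 0 + z 0 1 * D (z 1 0)) := by
  rw [hn, Matrix.det_fin_two, map_sub, D.leibniz, D.leibniz]
  simp only [smul_eq_mul]
  ring

theorem unit_zpow_pred_mul : ((n ^ (k - 1) : Rˣ) : R) * n = ((n ^ k : Rˣ) : R) := by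
  rw [← Units.val_mul, ← zpow_add_one, sub_add_cancel]

/-- Left multiplication acts on the generating polynomial through first-order differential operators
in `s`. -/
theorem derivation_left_mul (hn : (n : R) = z.det) (α : Matrix (Fin 2) (Fin 2) R)
    (hD : ∀ i c, D (z i c) = -(α * z) i c) :
    D (matCoeff z n a b j k) =
      -((α 0 0 * (j + k : ℤ) + α 1 1 * (a + b - j + k : ℤ)) * matCoeff z n a b j k +
        α 1 0 * (j + 1 : ℤ) * matCoeff z n a b (j + 1) k +
        α 0 1 * (a + b - j + 1 : ℤ) * matCoeff z n a b (j - 1) k) := by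
  have hA := natCast_mul_pow_pred (rowPoly z 0) a
  have hB := natCast_mul_pow_pred (rowPoly z 1) b
  have key : (a : R[X]) * (rowPoly z 0 ^ (a - 1) * rowPoly z 1 ^ b) *
            (X * C (D (z 0 0)) + C (D (z 1 0))) +
          (b : R[X]) * (rowPoly z 0 ^ a * rowPoly z 1 ^ (b - 1)) *
            (X * C (D (z 0 1)) + C (D (z 1 1))) =
      -(C (α 1 0) * derivative (rowPoly z 0 ^ a * rowPoly z 1 ^ b) +
        C (α 0 0) * (X * derivative (rowPoly z 0 ^ a * rowPoly z 1 ^ b)) +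
        C (α 0 1) * (((a + b : ℕ) : R[X]) * (X * (rowPoly z 0 ^ a * rowPoly z 1 ^ b)) -
          X * (X * derivative (rowPoly z 0 ^ a * rowPoly z 1 ^ b))) +
        C (α 1 1) * (((a + b : ℕ) : R[X]) * (rowPoly z 0 ^ a * rowPoly z 1 ^ b) -
          X * derivative (rowPoly z 0 ^ a * rowPoly z 1 ^ b))) := by
    have d0 : ∀ c, derivative (rowPoly z c) = C (z 0 c) := by intro c; simp [rowPoly]
    rw [derivative_mul, derivative_pow, derivative_pow, d0, d0]
    simp only [hD, Matrix.mul_apply, Fin.sum_univ_two, map_neg, map_add, map_mul, C_eq_natCast]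
    push_cast
    have e0 : rowPoly z 0 = X * C (z 0 0) + C (z 1 0) := rfl
    have e1 : rowPoly z 1 = X * C (z 0 1) + C (z 1 1) := rfl
    linear_combination (C (α 0 1) * X + C (α 1 1)) * rowPoly z 1 ^ b * hA +
      (C (α 0 1) * X + C (α 1 1)) * rowPoly z 0 ^ a * hB +
      (C (α 0 1) * X + C (α 1 1)) * a * rowPoly z 0 ^ (a - 1) * rowPoly z 1 ^ b * e0 +
      (C (α 0 1) * X + C (α 1 1)) * b * rowPoly z 0 ^ a * rowPoly z 1 ^ (b - 1) * e1
  rw [derivation_matCoeff, key, derivation_det z n hn]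
  simp only [zcoeff_neg, zcoeff_add, zcoeff_sub, zcoeff_C_mul, zcoeff_natCast_mul, zcoeff_X_mul,
    zcoeff_derivative, hD, Matrix.mul_apply, Fin.sum_univ_two, sub_add_cancel]
  have hk := unit_zpow_pred_mul n k
  rw [hn, Matrix.det_fin_two] at hk
  simp only [matCoeff]
  push_cast
  linear_combination (-(k : R) * zcoeff j (rowPoly z 0 ^ a * rowPoly z 1 ^ b) *
    (α 0 0 + α 1 1)) * hk

/-- Right multiplication transforms the two factors of the generating polynomial linearly. -/
theorem derivation_right_mul (hn : (n : R) = z.det) (δ : Matrix (Fin 2) (Fin 2) R)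
    (hD : ∀ i c, D (z i c) = (z * δ) i c) :
    D (matCoeff z n a b j k) =
      (δ 0 0 * (a + k : ℤ) + δ 1 1 * (b + k : ℤ)) * matCoeff z n a b j k +
        δ 1 0 * a * matCoeff z n (a - 1) (b + 1) j k +
        δ 0 1 * b * matCoeff z n (a + 1) (b - 1) j k := by
  have hA := natCast_mul_pow_pred (rowPoly z 0) a
  have hB := natCast_mul_pow_pred (rowPoly z 1) b
  have key : (a : R[X]) * (rowPoly z 0 ^ (a - 1) * rowPoly z 1 ^ b) *
            (X * C (D (z 0 0)) + C (D (z 1 0))) +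
          (b : R[X]) * (rowPoly z 0 ^ a * rowPoly z 1 ^ (b - 1)) *
            (X * C (D (z 0 1)) + C (D (z 1 1))) =
      C (δ 0 0) * ((a : R[X]) * (rowPoly z 0 ^ a * rowPoly z 1 ^ b)) +
      C (δ 1 0) * ((a : R[X]) * (rowPoly z 0 ^ (a - 1) * rowPoly z 1 ^ (b + 1))) +
      C (δ 0 1) * ((b : R[X]) * (rowPoly z 0 ^ (a + 1) * rowPoly z 1 ^ (b - 1))) +
      C (δ 1 1) * ((b : R[X]) * (rowPoly z 0 ^ a * rowPoly z 1 ^ b)) := by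
    simp only [hD, Matrix.mul_apply, Fin.sum_univ_two, map_add, map_mul]
    have e0 : rowPoly z 0 = X * C (z 0 0) + C (z 1 0) := rfl
    have e1 : rowPoly z 1 = X * C (z 0 1) + C (z 1 1) := rfl
    have hs : ∀ l c, rowPoly z c ^ (l + 1) = rowPoly z c ^ l * rowPoly z c :=
      fun l c => pow_succ _ _
    rw [hs b, hs a]
    linear_combination -C (δ 0 0) * rowPoly z 1 ^ b * hA - C (δ 1 1) * rowPoly z 0 ^ a * hB -
      (a : R[X]) * rowPoly z 0 ^ (a - 1) * rowPoly z 1 ^ b * (C (δ 0 0) * e0 + C (δ 1 0) * e1) -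
      (b : R[X]) * rowPoly z 0 ^ a * rowPoly z 1 ^ (b - 1) * (C (δ 0 1) * e0 + C (δ 1 1) * e1)
  rw [derivation_matCoeff, key, derivation_det z n hn]
  simp only [zcoeff_add, zcoeff_C_mul, zcoeff_natCast_mul, hD, Matrix.mul_apply,
    Fin.sum_univ_two]
  have hk := unit_zpow_pred_mul n k
  rw [hn, Matrix.det_fin_two] at hk
  simp only [matCoeff]
  push_cast
  linear_combination ((k : R) * zcoeff j (rowPoly z 0 ^ a * rowPoly z 1 ^ b) *
    (δ 0 0 + δ 1 1)) * hk

/-- Translations map `t^l N^k` to a combination of `t^{l-1/2} N^k` and `t^{l+1/2} N^{k-1}`; the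
coefficients vanish exactly for `2l + k + 1 = 0` and for `k = 0`. -/
theorem derivation_translation (hn : (n : R) = z.det) (β : Matrix (Fin 2) (Fin 2) R)
    (hD : ∀ i c, D (z i c) = -β i c) :
    (a + b + 1 : ℕ) * D (matCoeff z n a b j k) =
      -(β 0 0 * (a * (a + b + 1 + k : ℤ) * matCoeff z n (a - 1) b (j - 1) k +
          k * (a + b + 1 - j : ℤ) * matCoeff z n a (b + 1) j (k - 1)) +
        β 1 0 * (a * (a + b + 1 + k : ℤ) * matCoeff z n (a - 1) b j k -
          k * (j + 1 : ℤ) * matCoeff z n a (b + 1) (j + 1) (k - 1)) +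
        β 0 1 * (b * (a + b + 1 + k : ℤ) * matCoeff z n a (b - 1) (j - 1) k -
          k * (a + b + 1 - j : ℤ) * matCoeff z n (a + 1) b j (k - 1)) +
        β 1 1 * (b * (a + b + 1 + k : ℤ) * matCoeff z n a (b - 1) j k +
          k * (j + 1 : ℤ) * matCoeff z n (a + 1) b (j + 1) (k - 1))) := by
  have key : (a : R[X]) * (rowPoly z 0 ^ (a - 1) * rowPoly z 1 ^ b) *
            (X * C (D (z 0 0)) + C (D (z 1 0))) +
          (b : R[X]) * (rowPoly z 0 ^ a * rowPoly z 1 ^ (b - 1)) *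
            (X * C (D (z 0 1)) + C (D (z 1 1))) =
      -(C (β 0 0) * (X * ((a : R[X]) * (rowPoly z 0 ^ (a - 1) * rowPoly z 1 ^ b))) +
      C (β 1 0) * ((a : R[X]) * (rowPoly z 0 ^ (a - 1) * rowPoly z 1 ^ b)) +
      C (β 0 1) * (X * ((b : R[X]) * (rowPoly z 0 ^ a * rowPoly z 1 ^ (b - 1)))) +
      C (β 1 1) * ((b : R[X]) * (rowPoly z 0 ^ a * rowPoly z 1 ^ (b - 1)))) := by
    simp only [hD, map_neg]
    ring
  have h00 := entry00_mul_matCoeff z n hn a b j (k - 1)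
  have h01 := entry01_mul_matCoeff z n hn a b j (k - 1)
  have h10 := entry10_mul_matCoeff z n hn a b j (k - 1)
  have h11 := entry11_mul_matCoeff z n hn a b j (k - 1)
  rw [derivation_matCoeff, key, derivation_det z n hn]
  simp only [zcoeff_neg, zcoeff_add, zcoeff_C_mul, zcoeff_natCast_mul, zcoeff_X_mul, hD]
  rw [sub_add_cancel] at h00 h01 h10 h11
  simp only [matCoeff] at *
  push_cast at *
  linear_combination -(k : R) * (β 0 0 * h11 + β 1 1 * h00 - β 0 1 * h10 - β 1 0 * h01)

/-- The quadratic vector fields `z γ z`, before the products with the entries of `z` are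
expanded. -/
theorem derivation_inversion (hn : (n : R) = z.det) (γ : Matrix (Fin 2) (Fin 2) R)
    (hD : ∀ i c, D (z i c) = (z * γ * z) i c) :
    D (matCoeff z n a b j k) =
      (a + b + k : ℤ) * (γ * z).trace * matCoeff z n a b j k -
        γ 0 0 * b * matCoeff z n a (b - 1) j (k + 1) +
        γ 0 1 * b * matCoeff z n a (b - 1) (j - 1) (k + 1) +
        γ 1 0 * a * matCoeff z n (a - 1) b j (k + 1) -
        γ 1 1 * a * matCoeff z n (a - 1) b (j - 1) (k + 1) := by
  have hA := natCast_mul_pow_pred (rowPoly z 0) a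
  have hB := natCast_mul_pow_pred (rowPoly z 1) b
  have e0 : rowPoly z 0 = X * C (z 0 0) + C (z 1 0) := rfl
  have e1 : rowPoly z 1 = X * C (z 0 1) + C (z 1 1) := rfl
  have key : (a : R[X]) * (rowPoly z 0 ^ (a - 1) * rowPoly z 1 ^ b) *
            (X * C (D (z 0 0)) + C (D (z 1 0))) +
          (b : R[X]) * (rowPoly z 0 ^ a * rowPoly z 1 ^ (b - 1)) *
            (X * C (D (z 0 1)) + C (D (z 1 1))) =
      C (γ * z).trace * (((a + b : ℕ) : R[X]) * (rowPoly z 0 ^ a * rowPoly z 1 ^ b)) +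
      C z.det * (-(C (γ 0 0) * ((b : R[X]) * (rowPoly z 0 ^ a * rowPoly z 1 ^ (b - 1)))) +
      C (γ 0 1) * ((b : R[X]) * (X * (rowPoly z 0 ^ a * rowPoly z 1 ^ (b - 1)))) +
      C (γ 1 0) * ((a : R[X]) * (rowPoly z 0 ^ (a - 1) * rowPoly z 1 ^ b)) -
      C (γ 1 1) * ((a : R[X]) * (X * (rowPoly z 0 ^ (a - 1) * rowPoly z 1 ^ b)))) := by
    simp only [hD, Matrix.mul_apply, Fin.sum_univ_two, Matrix.trace_fin_two, Matrix.det_fin_two,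
      map_add, map_sub, map_mul]
    push_cast
    set t : R[X] := C (γ 0 0) * C (z 0 0) + C (γ 0 1) * C (z 1 0) +
      (C (γ 1 0) * C (z 0 1) + C (γ 1 1) * C (z 1 1)) with ht
    linear_combination -t * rowPoly z 1 ^ b * hA - t * rowPoly z 0 ^ a * hB -
      (a : R[X]) * rowPoly z 0 ^ (a - 1) * rowPoly z 1 ^ b * t * e0 -
      (b : R[X]) * rowPoly z 0 ^ a * rowPoly z 1 ^ (b - 1) * t * e1
  rw [derivation_matCoeff, key, derivation_det z n hn]
  simp only [zcoeff_neg, zcoeff_add, zcoeff_sub, zcoeff_C_mul, zcoeff_natCast_mul, zcoeff_X_mul]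
  simp only [hD, Matrix.mul_apply, Fin.sum_univ_two, Matrix.trace_fin_two]
  have hk := unit_zpow_pred_mul n k
  rw [hn, Matrix.det_fin_two] at hk
  simp only [matCoeff, zpow_add_one, Units.val_mul, hn, Matrix.det_fin_two]
  push_cast
  linear_combination ((k : R) * zcoeff j (rowPoly z 0 ^ a * rowPoly z 1 ^ b) *
    (γ 0 0 * z 0 0 + γ 0 1 * z 1 0 + (γ 1 0 * z 0 1 + γ 1 1 * z 1 1))) * hk

/-- The quadratic vector fields `z γ z`, corrected by the multiplier `c tr(γ z)`, map `t^l N^k` to a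
combination of `t^{l+1/2} N^k` and `t^{l-1/2} N^{k+1}`. For `c = 3` the coefficients vanish
exactly for `2l + k + 3 = 0` and for `k = -2`. -/
theorem derivation_inversion_add (hn : (n : R) = z.det) (γ : Matrix (Fin 2) (Fin 2) R)
    (hD : ∀ i c, D (z i c) = (z * γ * z) i c) :
    (a + b + 1 : ℕ) * (D (matCoeff z n a b j k) + 3 * (γ * z).trace * matCoeff z n a b j k) =
      γ 0 0 * ((a + b + k + 3 : ℤ) * (j + 1 : ℤ) * matCoeff z n (a + 1) b (j + 1) k +
          b * (k + 2 : ℤ) * matCoeff z n a (b - 1) j (k + 1)) +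
        γ 0 1 * ((a + b + k + 3 : ℤ) * (a + b + 1 - j : ℤ) * matCoeff z n (a + 1) b j k -
          b * (k + 2 : ℤ) * matCoeff z n a (b - 1) (j - 1) (k + 1)) +
        γ 1 0 * ((a + b + k + 3 : ℤ) * (j + 1 : ℤ) * matCoeff z n a (b + 1) (j + 1) k -
          a * (k + 2 : ℤ) * matCoeff z n (a - 1) b j (k + 1)) +
        γ 1 1 * ((a + b + k + 3 : ℤ) * (a + b + 1 - j : ℤ) * matCoeff z n a (b + 1) j k +
          a * (k + 2 : ℤ) * matCoeff z n (a - 1) b (j - 1) (k + 1)) := by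
  have h00 := entry00_mul_matCoeff z n hn a b j k
  have h01 := entry01_mul_matCoeff z n hn a b j k
  have h10 := entry10_mul_matCoeff z n hn a b j k
  have h11 := entry11_mul_matCoeff z n hn a b j k
  rw [derivation_inversion z n D a b j k hn γ hD, Matrix.trace_fin_two]
  simp only [Matrix.mul_apply, Fin.sum_univ_two]
  push_cast at *
  linear_combination (a + b + k + 3 : R) *
    (γ 0 0 * h00 + γ 0 1 * h10 + γ 1 0 * h01 + γ 1 1 * h11)

end BlockFormulas

/-! ### The action of the four blocks -/

/-- The generic matrix `Z`, with entries in `Zh`. -/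
def zMat : Matrix (Fin 2) (Fin 2) Zh := Matrix.of zc

/-- `N(Z)` as a unit of `Zh`. -/
def nUnit : Zhˣ := ⟨nZ, nInv, nZ_mul_nInv, by rw [mul_comm]; exact nZ_mul_nInv⟩

theorem nUnit_eq_det : (nUnit : Zh) = zMat.det := by
  rw [Matrix.det_fin_two]; rfl

/-- The coefficient of `s ^ j` in `(s z₁₁ + z₂₁) ^ a (s z₁₂ + z₂₂) ^ b`, times `N(Z) ^ k`. In
contrast to `tN` the exponent `j` is an arbitrary integer. -/
def tFun (a b : ℕ) (j k : ℤ) : Zh := matCoeff zMat nUnit a b j k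

theorem nUnit_zpow_apply (k : ℤ) (Z : HCx) :
    (((nUnit ^ k : Zhˣ) : Zh) : HCx → ℂ) Z = Z.val.det ^ k := by
  have h : evalZh Z ((nUnit ^ k : Zhˣ) : Zh) =
      ((Units.map (evalZh Z : Zh →* ℂ) nUnit ^ k : ℂˣ) : ℂ) := by
    rw [← map_zpow]; rfl
  rw [Units.val_zpow_eq_zpow_val] at h
  have h' : evalZh Z (nUnit : Zh) = Z.val.det := nZ_apply Z
  exact h.trans (congrArg (· ^ k) h')

theorem tN_eq_tFun (p i j : ℕ) (k : ℤ) : tN p i j k = tFun i (p - i) j k := by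
  apply Subtype.ext
  funext Z
  have h : tFun i (p - i) j k = tPoly p i j * ((nUnit ^ k : Zhˣ) : Zh) := by
    rw [tFun, matCoeff, zcoeff_natCast]; rfl
  rw [h]
  change tNFun p i j k Z = (tPoly p i j : HCx → ℂ) Z * (((nUnit ^ k : Zhˣ) : Zh) : HCx → ℂ) Z
  rw [nUnit_zpow_apply, tPoly_apply]
  rfl

theorem tFun_eq_tN (a b j : ℕ) (k : ℤ) : tFun a b j k = tN (a + b) a j k := by
  rw [tN_eq_tFun, Nat.add_sub_cancel_left]

theorem tFun_eq_zero (a b : ℕ) (j k : ℤ) (h : j < 0 ∨ (a + b : ℤ) < j) : tFun a b j k = 0 :=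
  h.elim (matCoeff_of_neg _ _ _ _ _) (matCoeff_of_lt _ _ _ _ _)

/-- The element of `gl(2, HC)` whose only nonzero block is `M`, in position `(r, c)`. -/
def block (r c : Fin 2) (M : HC) : gl2HC := Matrix.single r c M

theorem eq_sum_block (X : gl2HC) : X = block 0 0 (X 0 0) + block 0 1 (X 0 1) +
    (block 1 0 (X 1 0) + block 1 1 (X 1 1)) := by
  rw [Matrix.matrix_eq_sum_single X]
  simp [Fin.sum_univ_two, block]

theorem lie_eq (X : gl2HC) (f : Zh) : ⁅X, f⁆ = flowDeriv X f + cocycle 2 X * f := varpi_eq 2 X f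

section

variable (a b : ℕ) (j k : ℤ)

theorem lie_block00_tFun (α : HC) :
    ⁅block 0 0 α, tFun a b j k⁆ =
      -((α 0 0 * (j + k + 1) + α 1 1 * (a + b - j + k + 1)) • tFun a b j k +
        (α 1 0 * (j + 1)) • tFun a b (j + 1) k +
        (α 0 1 * (a + b - j + 1)) • tFun a b (j - 1) k) := by
  have h := derivation_left_mul zMat nUnit ((flowDeriv (block 0 0 α)).restrictScalars ℤ) a b j k
    nUnit_eq_det (α.map (algebraMap ℂ Zh)) (fun i c => by
      change flowDeriv _ (zc i c) = _
      rw [flowDeriv_zc]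
      simp [vfield, block, zMat, Matrix.mul_apply, Algebra.smul_def])
  change flowDeriv _ (tFun a b j k) = _ at h
  have hc : cocycle 2 (block 0 0 α) = -(algebraMap ℂ Zh (α 0 0) + algebraMap ℂ Zh (α 1 1)) := by
    simp [cocycle, block, Matrix.trace_fin_two, add_comm]
  rw [lie_eq, h, hc]
  simp only [tFun, Algebra.smul_def, map_mul, map_add, map_sub, map_intCast, map_natCast,
    map_one, Matrix.map_apply]
  push_cast
  ring

theorem lie_block11_tFun (δ : HC) :
    ⁅block 1 1 δ, tFun a b j k⁆ =
      (δ 0 0 * (a + k + 2) + δ 1 1 * (b + k + 2)) • tFun a b j k +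
        (δ 1 0 * a) • tFun (a - 1) (b + 1) j k +
        (δ 0 1 * b) • tFun (a + 1) (b - 1) j k := by
  have h := derivation_right_mul zMat nUnit ((flowDeriv (block 1 1 δ)).restrictScalars ℤ) a b j k
    nUnit_eq_det (δ.map (algebraMap ℂ Zh)) (fun i c => by
      change flowDeriv _ (zc i c) = _
      rw [flowDeriv_zc]
      simp [vfield, block, zMat, Matrix.mul_apply, Algebra.smul_def, mul_comm])
  change flowDeriv _ (tFun a b j k) = _ at h
  have hc : cocycle 2 (block 1 1 δ) =
      2 * (algebraMap ℂ Zh (δ 0 0) + algebraMap ℂ Zh (δ 1 1)) := by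
    simp [cocycle, block, Matrix.trace_fin_two, map_ofNat (algebraMap ℂ Zh)]
  rw [lie_eq, h, hc]
  simp only [tFun, Algebra.smul_def, map_mul, map_add, map_natCast, map_intCast, map_ofNat,
    Matrix.map_apply]
  push_cast
  ring

theorem lie_block01_tFun (β : HC) :
    (a + b + 1 : ℂ) • ⁅block 0 1 β, tFun a b j k⁆ =
      -(β 0 0 • ((a * (a + b + 1 + k) : ℂ) • tFun (a - 1) b (j - 1) k +
          (k * (a + b + 1 - j) : ℂ) • tFun a (b + 1) j (k - 1)) +
        β 1 0 • ((a * (a + b + 1 + k) : ℂ) • tFun (a - 1) b j k -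
          (k * (j + 1) : ℂ) • tFun a (b + 1) (j + 1) (k - 1)) +
        β 0 1 • ((b * (a + b + 1 + k) : ℂ) • tFun a (b - 1) (j - 1) k -
          (k * (a + b + 1 - j) : ℂ) • tFun (a + 1) b j (k - 1)) +
        β 1 1 • ((b * (a + b + 1 + k) : ℂ) • tFun a (b - 1) j k +
          (k * (j + 1) : ℂ) • tFun (a + 1) b (j + 1) (k - 1))) := by
  have h := derivation_translation zMat nUnit ((flowDeriv (block 0 1 β)).restrictScalars ℤ) a b j k
    nUnit_eq_det (β.map (algebraMap ℂ Zh)) (fun i c => by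
      change flowDeriv _ (zc i c) = _
      rw [flowDeriv_zc]
      simp [vfield, block])
  change _ * flowDeriv _ (tFun a b j k) = _ at h
  have hc : cocycle 2 (block 0 1 β) = 0 := by
    simp [cocycle, block]
  rw [lie_eq, hc, zero_mul, add_zero]
  simp only [tFun, Algebra.smul_def, map_mul, map_add, map_sub, map_natCast, map_intCast,
    map_one, Matrix.map_apply] at h ⊢
  push_cast at h ⊢
  linear_combination h

theorem lie_block10_tFun (γ : HC) :
    (a + b + 1 : ℂ) • ⁅block 1 0 γ, tFun a b j k⁆ =
      γ 0 0 • (((a + b + k + 3) * (j + 1) : ℂ) • tFun (a + 1) b (j + 1) k +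
          (b * (k + 2) : ℂ) • tFun a (b - 1) j (k + 1)) +
        γ 0 1 • (((a + b + k + 3) * (a + b + 1 - j) : ℂ) • tFun (a + 1) b j k -
          (b * (k + 2) : ℂ) • tFun a (b - 1) (j - 1) (k + 1)) +
        γ 1 0 • (((a + b + k + 3) * (j + 1) : ℂ) • tFun a (b + 1) (j + 1) k -
          (a * (k + 2) : ℂ) • tFun (a - 1) b j (k + 1)) +
        γ 1 1 • (((a + b + k + 3) * (a + b + 1 - j) : ℂ) • tFun a (b + 1) j k +
          (a * (k + 2) : ℂ) • tFun (a - 1) b (j - 1) (k + 1)) := by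
  have h := derivation_inversion_add zMat nUnit ((flowDeriv (block 1 0 γ)).restrictScalars ℤ) a b
    j k nUnit_eq_det (γ.map (algebraMap ℂ Zh)) (fun i c => by
      change flowDeriv _ (zc i c) = _
      rw [flowDeriv_zc]
      simp [vfield, block, zMat, Matrix.mul_apply, Algebra.smul_def, Fin.sum_univ_two]
      ring)
  change _ * (flowDeriv _ (tFun a b j k) + _ * tFun a b j k) = _ at h
  have hc : cocycle 2 (block 1 0 γ) = 3 * (γ.map (algebraMap ℂ Zh) * zMat).trace := by
    have h3 : ((2 : ℂ) + 1) = 3 := by norm_num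
    simp [cocycle, block, Matrix.trace_fin_two, Matrix.mul_apply, zMat, Fin.sum_univ_two,
      Algebra.smul_def, h3, map_ofNat (algebraMap ℂ Zh)]
    ring
  rw [lie_eq, hc]
  simp only [tFun, Algebra.smul_def, map_mul, map_add, map_sub, map_natCast, map_intCast,
    map_one, map_ofNat, Matrix.map_apply] at h ⊢
  push_cast at h ⊢
  linear_combination h

end

/-! ### Diagonalization -/

/-- A subspace stable under a family of operators that are diagonal in `b` and separate the indices
contains every `b i` that occurs in one of its elements. -/
theorem mem_of_linearCombination_mem {K V ι κ : Type*} [Field K] [AddCommGroup V] [Module K V]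
    {b : ι → V} {T : κ → V →ₗ[K] V} {μ : κ → ι → K} (hT : ∀ c i, T c (b i) = μ c i • b i)
    (hsep : ∀ i i', i ≠ i' → ∃ c, μ c i ≠ μ c i') {W : Submodule K V}
    (hW : ∀ c, ∀ w ∈ W, T c w ∈ W) (f : ι →₀ K) (hf : Finsupp.linearCombination K b f ∈ W)
    {i : ι} (hi : f i ≠ 0) : b i ∈ W := by
  induction hm : f.support.card using Nat.strong_induction_on generalizing f with
  | _ m ih =>
  by_cases h : ∃ i', i' ≠ i ∧ f i' ≠ 0
  · obtain ⟨i', hne, hi'⟩ := h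
    obtain ⟨c, hc⟩ := hsep i i' hne.symm
    -- `T c - μ c i'` removes the index `i'` from the support and keeps `i`
    let g : ι →₀ K := Finsupp.onFinset f.support (fun x => (μ c x - μ c i') * f x) (by
      intro x hx
      exact Finsupp.mem_support_iff.mpr (right_ne_zero_of_mul hx))
    have hg : Finsupp.linearCombination K b g =
        T c (Finsupp.linearCombination K b f) - μ c i' • Finsupp.linearCombination K b f := by
      rw [Finsupp.linearCombination_apply, Finsupp.linearCombination_apply,
        Finsupp.sum_of_support_subset g Finsupp.support_onFinset_subset _ (by simp), Finsupp.sum,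
        map_sum, Finset.smul_sum, ← Finset.sum_sub_distrib]
      refine Finset.sum_congr rfl fun x _ => ?_
      rw [map_smul, hT, Finsupp.onFinset_apply]
      module
    have hsub : g.support ⊂ f.support := by
      refine Finset.ssubset_iff_of_subset Finsupp.support_onFinset_subset |>.mpr ⟨i', ?_, ?_⟩
      · exact Finsupp.mem_support_iff.mpr hi'
      · simp
    refine ih _ (hm ▸ Finset.card_lt_card hsub) g ?_ ?_ rfl
    · rw [hg]
      exact W.sub_mem (hW c _ hf) (W.smul_mem _ hf)
    · exact mul_ne_zero (sub_ne_zero.mpr hc) hi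
  · have hfi : f = Finsupp.single i (f i) := by
      ext x
      by_cases hx : x = i
      · subst hx; simp
      · rw [Finsupp.single_eq_of_ne hx]
        by_contra h0
        exact h ⟨x, hx, h0⟩
    rw [hfi, Finsupp.linearCombination_single] at hf
    exact (W.smul_mem_iff hi).mp hf

/-- The index set of the functions `tN p i j k`. -/
@[ext]
structure TIndex where
  /-- twice the spin -/
  p : ℕ
  /-- the degree in the first column -/
  i : ℕ
  /-- the degree in the first row -/
  j : ℕ
  /-- the exponent of the norm -/
  k : ℤ
  hi : i ≤ p
  hj : j ≤ p

/-- The function `tN p i j k`, for a bundled index. -/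
def TIndex.toZh (x : TIndex) : Zh := tN x.p x.i x.j x.k

theorem TIndex.toZh_eq (x : TIndex) : x.toZh = tFun x.i (x.p - x.i) x.j x.k := tN_eq_tFun _ _ _ _

/-- Matrix units of the `2 × 2` matrices. -/
def unitM (r c : Fin 2) : HC := Matrix.single r c 1

/-- Three elements of the diagonal torus, and a product of a raising and a lowering operator (which
plays the role of a Casimir operator). They are diagonal on the functions `tN p i j k` and
separate them. -/
def diagOp : Fin 4 → Zh →ₗ[ℂ] Zh :=
  ![LieModule.toEnd ℂ gl2HC Zh (block 0 0 (unitM 0 0)),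
    LieModule.toEnd ℂ gl2HC Zh (block 0 0 (unitM 1 1)),
    LieModule.toEnd ℂ gl2HC Zh (block 1 1 (unitM 0 0)),
    LieModule.toEnd ℂ gl2HC Zh (block 0 0 (unitM 0 1)) ∘ₗ
      LieModule.toEnd ℂ gl2HC Zh (block 0 0 (unitM 1 0))]

/-- The eigenvalues of the operators `diagOp`. -/
def diagEig : Fin 4 → TIndex → ℂ :=
  ![fun x => -(x.j + x.k + 1), fun x => -(x.p - x.j + x.k + 1), fun x => x.i + x.k + 2,
    fun x => (x.j + 1) * (x.p - x.j)]

theorem lie_row_succ (a b : ℕ) (j k : ℤ) :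
    ⁅block 0 0 (unitM 1 0), tFun a b j k⁆ = (-(j + 1) : ℂ) • tFun a b (j + 1) k := by
  rw [lie_block00_tFun]
  simp only [unitM, Matrix.single_apply]
  simp
  module

theorem lie_row_pred (a b : ℕ) (j k : ℤ) :
    ⁅block 0 0 (unitM 0 1), tFun a b j k⁆ = (-(a + b - j + 1) : ℂ) • tFun a b (j - 1) k := by
  rw [lie_block00_tFun]
  simp only [unitM, Matrix.single_apply]
  simp
  module

theorem lie_col_pred (a b : ℕ) (j k : ℤ) :
    ⁅block 1 1 (unitM 1 0), tFun a b j k⁆ = (a : ℂ) • tFun (a - 1) (b + 1) j k := by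
  rw [lie_block11_tFun]
  simp [unitM]

theorem lie_col_succ (a b : ℕ) (j k : ℤ) :
    ⁅block 1 1 (unitM 0 1), tFun a b j k⁆ = (b : ℂ) • tFun (a + 1) (b - 1) j k := by
  rw [lie_block11_tFun]
  simp [unitM]

theorem diagOp_toZh (c : Fin 4) (x : TIndex) : diagOp c x.toZh = diagEig c x • x.toZh := by
  have hp : (x.i : ℂ) + ((x.p - x.i : ℕ) : ℂ) = x.p := by
    rw [Nat.cast_sub x.hi]; ring
  rw [x.toZh_eq]
  fin_cases c
  · simp only [diagOp, diagEig, Fin.zero_eta, Matrix.cons_val_zero, LieModule.toEnd_apply_apply,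
      lie_block00_tFun]
    simp [unitM]
    module
  · simp only [diagOp, diagEig, Fin.mk_one, Matrix.cons_val_one, Matrix.cons_val_zero,
      LieModule.toEnd_apply_apply, lie_block00_tFun, hp]
    simp [unitM]
    module
  · simp only [diagOp, diagEig, Fin.reduceFinMk, Matrix.cons_val,
      LieModule.toEnd_apply_apply, lie_block11_tFun]
    simp [unitM]
  · simp only [diagOp, diagEig, Fin.reduceFinMk, Matrix.cons_val, LinearMap.comp_apply,
      LieModule.toEnd_apply_apply, lie_row_succ, lie_smul, lie_row_pred, hp, smul_smul,
      add_sub_cancel_right]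
    congr 1
    push_cast
    ring

theorem exists_diagEig_ne (x y : TIndex) (hxy : x ≠ y) : ∃ c, diagEig c x ≠ diagEig c y := by
  by_contra! h
  apply hxy
  have h0 : -((x.j : ℂ) + x.k + 1) = -(y.j + y.k + 1) := h 0
  have h1 : -((x.p : ℂ) - x.j + x.k + 1) = -(y.p - y.j + y.k + 1) := h 1
  have h2 : (x.i : ℂ) + x.k + 2 = y.i + y.k + 2 := h 2
  have h3 : ((x.j : ℂ) + 1) * (x.p - x.j) = (y.j + 1) * (y.p - y.j) := h 3
  have h0' : -((x.j : ℤ) + x.k + 1) = -(y.j + y.k + 1) := by exact_mod_cast h0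
  have h1' : -((x.p : ℤ) - x.j + x.k + 1) = -(y.p - y.j + y.k + 1) := by exact_mod_cast h1
  have h2' : (x.i : ℤ) + x.k + 2 = y.i + y.k + 2 := by exact_mod_cast h2
  have h3' : ((x.j : ℤ) + 1) * (x.p - x.j) = (y.j + 1) * (y.p - y.j) := by exact_mod_cast h3
  have hp : (y.p : ℤ) = x.p + 2 * (x.k - y.k) := by linarith
  have hj : (y.j : ℤ) = x.j + (x.k - y.k) := by linarith
  -- the spins `p` and `-p-2` have the same Casimir eigenvalue, but only one of them is `≥ 0`
  have hprod : (x.k - y.k) * (x.p + 1 + (x.k - y.k)) = 0 := by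
    rw [hp, hj] at h3'
    linear_combination -h3'
  have hk : x.k = y.k := by
    rcases mul_eq_zero.mp hprod with h | h <;> omega
  ext <;> omega

theorem tFun_zero_ne_zero (a b : ℕ) (k : ℤ) : tFun a b 0 k ≠ 0 := by
  intro h
  let Z : HCx := ⟨!![1, 0; 1, 1], !![1, 0; -1, 1], by simp [Matrix.one_fin_two],
    by simp [Matrix.one_fin_two]⟩
  have h1 := congrArg (evalZh Z) h
  have h2 : tFun a b 0 k = zc 1 0 ^ a * zc 1 1 ^ b * ((nUnit ^ k : Zhˣ) : Zh) := by
    rw [tFun, matCoeff, show (0 : ℤ) = ((0 : ℕ) : ℤ) from rfl, zcoeff_natCast, mul_coeff_zero,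
      coeff_zero_eq_eval_zero, coeff_zero_eq_eval_zero]
    simp [rowPoly, zMat]
  have h3 : evalZh Z ((nUnit ^ k : Zhˣ) : Zh) = Z.val.det ^ k := nUnit_zpow_apply k Z
  have h4 : ∀ i c, evalZh Z (zc i c) = Z.val i c := fun _ _ => rfl
  rw [h2, map_mul, map_mul, map_pow, map_pow, h3, h4, h4, map_zero] at h1
  simp [Z, Matrix.det_fin_two] at h1

theorem tFun_ne_zero (a b j : ℕ) (k : ℤ) (hj : j ≤ a + b) : tFun a b j k ≠ 0 := by
  induction j with
  | zero => exact tFun_zero_ne_zero a b k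
  | succ j ih =>
    intro h
    have h1 := lie_row_pred a b (j + 1 : ℕ) k
    rw [h, lie_zero] at h1
    have h2 : (-(a + b - ((j + 1 : ℕ) : ℤ) + 1) : ℂ) ≠ 0 := by
      have h3 : -((a : ℤ) + b - (j + 1 : ℕ) + 1) ≠ 0 := by omega
      exact_mod_cast h3
    refine ih (by omega) ?_
    have h4 := (smul_eq_zero.mp h1.symm).resolve_left h2
    simpa using h4

theorem TIndex.toZh_ne_zero (x : TIndex) : x.toZh ≠ 0 := by
  rw [x.toZh_eq]
  exact tFun_ne_zero _ _ _ _ (by have := x.hi; have := x.hj; omega)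

theorem diagOp_mem (W : LieSubmodule ℂ gl2HC Zh) (c : Fin 4) (w : Zh) (hw : w ∈ W.toSubmodule) :
    diagOp c w ∈ W.toSubmodule := by
  fin_cases c
  · exact W.lie_mem hw
  · exact W.lie_mem hw
  · exact W.lie_mem hw
  · exact W.lie_mem (W.lie_mem hw)

theorem linearIndependent_toZh : LinearIndependent ℂ TIndex.toZh := by
  rw [linearIndependent_iff]
  intro f hf
  ext x
  by_contra hx
  have := mem_of_linearCombination_mem diagOp_toZh exists_diagEig_ne (W := ⊥)
    (fun c w hw => by rw [(Submodule.mem_bot ℂ).mp hw, map_zero]; exact Submodule.zero_mem _)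
    f (by rw [hf]; exact Submodule.zero_mem _) hx
  exact x.toZh_ne_zero ((Submodule.mem_bot ℂ).mp this)

/-! ### Spans of matrix coefficients -/

theorem tN_mem_spanTN {R : ℤ → ℤ → Prop} {p i j : ℕ} {k : ℤ} (hi : i ≤ p) (hj : j ≤ p)
    (h : R p k) : tN p i j k ∈ spanTN R :=
  Submodule.subset_span ⟨p, i, j, k, hi, hj, h, rfl⟩

theorem tFun_mem_spanTN {R : ℤ → ℤ → Prop} {a b : ℕ} {j k : ℤ} (h : R (a + b) k) :
    tFun a b j k ∈ spanTN R := by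
  by_cases hj : 0 ≤ j ∧ j ≤ a + b
  · obtain ⟨m, rfl⟩ := Int.eq_ofNat_of_zero_le hj.1
    rw [tFun_eq_tN]
    exact tN_mem_spanTN (by omega) (by omega) (by push_cast; exact h)
  · rw [tFun_eq_zero _ _ _ _ (by omega)]
    exact Submodule.zero_mem _

/-- To map `spanTN R` into a subspace it is enough to map the functions `tFun` into it. -/
theorem map_mem_of_mem_spanTN {R : ℤ → ℤ → Prop} {S : Submodule ℂ Zh} (φ : Zh →ₗ[ℂ] Zh)
    (h : ∀ (a b : ℕ) (j k : ℤ), R (a + b) k → φ (tFun a b j k) ∈ S) {f : Zh}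
    (hf : f ∈ spanTN R) : φ f ∈ S := by
  have : spanTN R ≤ S.comap φ := by
    refine Submodule.span_le.mpr ?_
    rintro _ ⟨p, i, j, k, hi, -, hR, rfl⟩
    change φ (tN p i j k) ∈ S
    rw [tN_eq_tFun]
    refine h _ _ _ _ ?_
    rwa [show (i : ℤ) + (p - i : ℕ) = p by omega]
  exact this hf

theorem smul_tFun_mem_spanTN {R : ℤ → ℤ → Prop} {c : ℂ} {a b : ℕ} {j k : ℤ}
    (h : c ≠ 0 → R (a + b) k) : c • tFun a b j k ∈ spanTN R := by
  by_cases hc : c = 0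
  · rw [hc, zero_smul]
    exact Submodule.zero_mem _
  · exact Submodule.smul_mem _ _ (tFun_mem_spanTN (h hc))

theorem nUnit_zpow_mul_mem_spanTN {R R' : ℤ → ℤ → Prop} (m : ℤ)
    (h : ∀ (p : ℕ) k, R p k → R' p (k + m)) {f : Zh} (hf : f ∈ spanTN R) :
    ((nUnit ^ m : Zhˣ) : Zh) * f ∈ spanTN R' := by
  refine map_mem_of_mem_spanTN (LinearMap.mulLeft ℂ ((nUnit ^ m : Zhˣ) : Zh)) ?_ hf
  intro a b j k hR
  rw [LinearMap.mulLeft_apply, mul_comm, tFun, matCoeff_mul_unit_zpow]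
  refine tFun_mem_spanTN ?_
  have := h (a + b) k
  push_cast at this
  exact this hR

/-- Multiplication by a coordinate maps `t^l N^k` to a combination of `t^{l+1/2} N^k` and
`t^{l-1/2} N^{k+1}`. -/
theorem zc_mul_mem_spanTN {R R' : ℤ → ℤ → Prop} (r c : Fin 2)
    (hup : ∀ (p : ℕ) k, R p k → R' (p + 1) k)
    (hdown : ∀ (p : ℕ) k, R (p + 1) k → R' p (k + 1)) {f : Zh} (hf : f ∈ spanTN R) :
    zc r c * f ∈ spanTN R' := by
  refine map_mem_of_mem_spanTN (LinearMap.mulLeft ℂ (zc r c)) ?_ hf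
  intro a b j k hR
  rw [LinearMap.mulLeft_apply]
  have hne : ((a + b + 1 : ℕ) : ℂ) ≠ 0 := Nat.cast_ne_zero.mpr (by omega)
  rw [← Submodule.smul_mem_iff _ hne]
  have hupR : R' ((a : ℤ) + b + 1) k := by
    have := hup (a + b) k
    push_cast at this
    exact this hR
  have hnat : ∀ (m : ℕ) (f : Zh), (m : Zh) * f = (m : ℂ) • f := by
    intro m f; rw [Algebra.smul_def, map_natCast]
  have hint : ∀ (m : ℤ) (f : Zh), (m : Zh) * f = (m : ℂ) • f := by
    intro m f; rw [Algebra.smul_def, map_intCast]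
  have hL : ∀ (x : ℂ) j, x • tFun (a + 1) b j k ∈ spanTN R' := fun x j =>
    Submodule.smul_mem _ _ (tFun_mem_spanTN (by
      push_cast
      rwa [show (a : ℤ) + 1 + b = a + b + 1 by ring]))
  have hL' : ∀ (x : ℂ) j, x • tFun a (b + 1) j k ∈ spanTN R' := fun x j =>
    Submodule.smul_mem _ _ (tFun_mem_spanTN (by push_cast; rwa [← add_assoc]))
  have hD : ∀ j, (a : ℂ) • tFun (a - 1) b j (k + 1) ∈ spanTN R' := fun j =>
    smul_tFun_mem_spanTN (by
      intro ha
      obtain ⟨a, rfl⟩ := Nat.exists_eq_succ_of_ne_zero (Nat.cast_ne_zero.mp ha)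
      have := hdown (a + b) k
      push_cast at this hR
      simp only [Nat.succ_eq_add_one, Nat.add_sub_cancel]
      exact this (by rwa [show (a : ℤ) + b + 1 = a + 1 + b by ring]))
  have hD' : ∀ j, (b : ℂ) • tFun a (b - 1) j (k + 1) ∈ spanTN R' := fun j =>
    smul_tFun_mem_spanTN (by
      intro hb
      obtain ⟨b, rfl⟩ := Nat.exists_eq_succ_of_ne_zero (Nat.cast_ne_zero.mp hb)
      have := hdown (a + b) k
      push_cast at this hR
      simp only [Nat.succ_eq_add_one, Nat.add_sub_cancel]
      exact this (by rwa [add_assoc]))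
  rw [← hnat]
  have h00 := entry00_mul_matCoeff zMat nUnit nUnit_eq_det a b j k
  have h01 := entry01_mul_matCoeff zMat nUnit nUnit_eq_det a b j k
  have h10 := entry10_mul_matCoeff zMat nUnit nUnit_eq_det a b j k
  have h11 := entry11_mul_matCoeff zMat nUnit nUnit_eq_det a b j k
  simp only [hnat, hint, zMat, Matrix.of_apply] at h00 h01 h10 h11
  rw [hnat]
  fin_cases r <;> fin_cases c
  · exact h00 ▸ Submodule.add_mem _ (hL _ _) (hD' _)
  · exact h01 ▸ Submodule.sub_mem _ (hL' _ _) (hD _)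
  · exact h10 ▸ Submodule.sub_mem _ (hL _ _) (hD' _)
  · exact h11 ▸ Submodule.add_mem _ (hL' _ _) (hD _)

theorem one_eq_tFun : (1 : Zh) = tFun 0 0 0 0 := by
  rw [tFun, matCoeff, show (0 : ℤ) = ((0 : ℕ) : ℤ) from rfl, zcoeff_natCast]
  simp

theorem one_mem_spanTN {R : ℤ → ℤ → Prop} (h : R 0 0) : (1 : Zh) ∈ spanTN R := by
  rw [one_eq_tFun]
  exact tFun_mem_spanTN (by simpa using h)

/-- A subspace of `Zh` stable under multiplication by the generators of an algebra of functions is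
stable under multiplication by that algebra. -/
theorem mul_mem_of_mem_adjoin {s : Set (HCx → ℂ)} {S : Submodule ℂ Zh}
    (hs : ∀ x ∈ s, ∃ y : Zh, (y : HCx → ℂ) = x ∧ ∀ g ∈ S, y * g ∈ S) {f : Zh}
    (hf : (f : HCx → ℂ) ∈ Algebra.adjoin ℂ s) {g : Zh} (hg : g ∈ S) : f * g ∈ S := by
  have key : ∀ x ∈ Algebra.adjoin ℂ s, ∃ y : Zh, (y : HCx → ℂ) = x ∧ ∀ g ∈ S, y * g ∈ S := by
    intro x hx
    induction hx using Algebra.adjoin_induction with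
    | mem x hx => exact hs x hx
    | algebraMap r =>
      refine ⟨algebraMap ℂ Zh r, rfl, fun g hg => ?_⟩
      rw [← Algebra.smul_def]
      exact S.smul_mem r hg
    | add x y _ _ hx hy =>
      obtain ⟨x', rfl, hx⟩ := hx
      obtain ⟨y', rfl, hy⟩ := hy
      refine ⟨x' + y', rfl, fun g hg => ?_⟩
      rw [add_mul]
      exact S.add_mem (hx g hg) (hy g hg)
    | mul x y _ _ hx hy =>
      obtain ⟨x', rfl, hx⟩ := hx
      obtain ⟨y', rfl, hy⟩ := hy
      refine ⟨x' * y', rfl, fun g hg => ?_⟩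
      rw [mul_assoc]
      exact hx _ (hy g hg)
  obtain ⟨y, hy, h⟩ := key f hf
  rw [← Subtype.ext hy]
  exact h g hg

theorem nInv_eq : nInv = ((nUnit ^ (-1 : ℤ) : Zhˣ) : Zh) := by
  rw [zpow_neg_one]; rfl

theorem spanTN_true : spanTN (fun _ _ => True) = ⊤ := by
  refine eq_top_iff.mpr fun f _ => ?_
  rw [← mul_one f]
  refine mul_mem_of_mem_adjoin ?_ f.2 (one_mem_spanTN trivial)
  rintro _ (⟨⟨r, c⟩, rfl⟩ | rfl)
  · exact ⟨zc r c, rfl, fun g hg =>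
      zc_mul_mem_spanTN r c (fun _ _ _ => trivial) (fun _ _ _ => trivial) hg⟩
  · refine ⟨nInv, rfl, fun g hg => ?_⟩
    rw [nInv_eq]
    exact nUnit_zpow_mul_mem_spanTN _ (fun _ _ _ => trivial) hg

/-! ### Polynomial functions and functions regular at infinity -/

theorem matCoeff_zero_mem {K R : Type*} [CommRing K] [CommRing R] [Algebra K R]
    (A : Subalgebra K R) (z : Matrix (Fin 2) (Fin 2) R) (n : Rˣ) (hz : ∀ i c, z i c ∈ A)
    (a b : ℕ) (j : ℤ) : matCoeff z n a b j 0 ∈ A := by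
  induction a generalizing j with
  | zero =>
    induction b generalizing j with
    | zero =>
      simp only [matCoeff, pow_zero, mul_one, zpow_zero, Units.val_one]
      unfold zcoeff
      split_ifs
      · rw [coeff_one]
        split_ifs
        exacts [A.one_mem, A.zero_mem]
      · exact A.zero_mem
    | succ b ih =>
      rw [matCoeff_succ_right]
      exact A.add_mem (A.mul_mem (hz 0 1) (ih _)) (A.mul_mem (hz 1 1) (ih _))
  | succ a ih =>
    rw [matCoeff_succ_left]
    exact A.add_mem (A.mul_mem (hz 0 0) (ih _)) (A.mul_mem (hz 1 0) (ih _))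

theorem map_matCoeff {R S : Type*} [CommRing R] [CommRing S] (φ : R →+* S)
    (z : Matrix (Fin 2) (Fin 2) R) (n : Rˣ) (a b : ℕ) (j k : ℤ) :
    φ (matCoeff z n a b j k) = matCoeff (z.map φ) (Units.map (φ : R →* S) n) a b j k := by
  have h : ∀ q : R[X], φ (zcoeff j q) = zcoeff j (q.map φ) := by
    intro q
    unfold zcoeff
    split_ifs
    · rw [coeff_map]
    · exact map_zero φ
  have hu : φ ((n ^ k : Rˣ) : R) = ((Units.map (φ : R →* S) n ^ k : Sˣ) : S) := by
    rw [← map_zpow]; rfl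
  rw [matCoeff, matCoeff, map_mul, h, hu]
  simp [rowPoly]

/-- Homogeneity in the matrix. The unit `n` is not scaled along. -/
theorem matCoeff_smul {R : Type*} [CommRing R] (c : R) (z : Matrix (Fin 2) (Fin 2) R) (n : Rˣ)
    (a b : ℕ) (j k : ℤ) : matCoeff (c • z) n a b j k = c ^ (a + b) * matCoeff z n a b j k := by
  have h : ∀ i, rowPoly (c • z) i = C c * rowPoly z i := by
    intro i; simp [rowPoly]; ring
  rw [matCoeff, matCoeff, h, h, mul_pow, mul_pow, ← C_pow, ← C_pow,
    show ∀ x y u v : R[X], x * y * (u * v) = x * u * (y * v) by intros; ring, ← C_mul,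
    zcoeff_C_mul, pow_add]
  ring

/-- The norm of an invertible matrix, as a nonzero complex number. -/
def detUnit (Z : HCx) : ℂˣ := Units.map (Matrix.detMonoidHom : HC →* ℂ) Z

theorem tFun_apply (a b : ℕ) (j k : ℤ) (Z : HCx) :
    (tFun a b j k : HCx → ℂ) Z = matCoeff Z.val (detUnit Z) a b j k := by
  change evalZh Z (tFun a b j k) = _
  rw [tFun, map_matCoeff]
  congr 1
  exact Units.ext (nZ_apply Z)

theorem nZ_mem_polyFun : (nZ : HCx → ℂ) ∈ polyFun :=
  have h : ∀ i c, coord i c ∈ polyFun := fun i c => Algebra.subset_adjoin ⟨(i, c), rfl⟩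
  polyFun.sub_mem (polyFun.mul_mem (h 0 0) (h 1 1)) (polyFun.mul_mem (h 0 1) (h 1 0))

theorem spanTN_eq_ZhPlus : spanTN (fun _ k => 0 ≤ k) = ZhPlus := by
  apply le_antisymm
  · intro f hf
    refine map_mem_of_mem_spanTN LinearMap.id ?_ hf
    intro a b j k hk
    obtain ⟨m, rfl⟩ := Int.eq_ofNat_of_zero_le hk
    have h1 : tFun a b j 0 ∈ polyFun.comap Zh.val := by
      refine matCoeff_zero_mem _ _ _ (fun i c => ?_) a b j
      exact Algebra.subset_adjoin ⟨(i, c), rfl⟩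
    have h2 : tFun a b j m = tFun a b j 0 * nZ ^ m := by
      rw [tFun, tFun, ← zero_add (m : ℤ), ← matCoeff_mul_unit_zpow, zpow_natCast,
        Units.val_pow_eq_pow_val]
      rfl
    change (tFun a b j m : HCx → ℂ) ∈ polyFun
    rw [h2]
    exact polyFun.mul_mem h1 (polyFun.pow_mem nZ_mem_polyFun m)
  · intro f hf
    rw [← mul_one f]
    refine mul_mem_of_mem_adjoin ?_ hf (one_mem_spanTN le_rfl)
    rintro _ ⟨⟨r, c⟩, rfl⟩
    exact ⟨zc r c, rfl, fun g hg =>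
      zc_mul_mem_spanTN r c (fun _ _ h => h) (fun _ _ h => by omega) hg⟩

theorem inv_val_eq (Z : HCx) : (Z⁻¹ : HCx).val = (Z.val.det)⁻¹ • Z.val.adjugate := by
  rw [Matrix.coe_units_inv, Matrix.inv_def, Ring.inverse_eq_inv']

theorem det_val_ne_zero (Z : HCx) : Z.val.det ≠ 0 :=
  ((Matrix.isUnit_iff_isUnit_det _).mp Z.isUnit).ne_zero

theorem spanTN_eq_ZhMinus : spanTN (fun p k => k ≤ -(p + 3)) = ZhMinus 2 := by
  apply le_antisymm
  · intro f hf
    refine map_mem_of_mem_spanTN LinearMap.id ?_ hf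
    intro a b j k hk
    obtain ⟨m, hm⟩ := Int.eq_ofNat_of_zero_le (a := -(a + b + k + 3)) (by omega)
    -- the entries of the adjugate matrix, as polynomial functions
    let z : Matrix (Fin 2) (Fin 2) (HCx → ℂ) := !![coord 1 1, -coord 0 1; -coord 1 0, coord 0 0]
    have hc : ∀ i c, coord i c ∈ polyFun := fun i c => Algebra.subset_adjoin ⟨(i, c), rfl⟩
    have hz : ∀ i c, z i c ∈ polyFun := by
      intro i c
      fin_cases i <;> fin_cases c
      exacts [hc 1 1, polyFun.neg_mem (hc 0 1), polyFun.neg_mem (hc 1 0), hc 0 0]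
    have hmem : matCoeff z 1 a b j 0 * (nZ : HCx → ℂ) ^ m ∈ polyFun :=
      polyFun.mul_mem (matCoeff_zero_mem _ z 1 hz a b j) (polyFun.pow_mem nZ_mem_polyFun m)
    change (fun Z : HCx => (tFun a b j k : HCx → ℂ) Z⁻¹ / Z.val.det ^ (2 + 1)) ∈ polyFun
    convert hmem using 1
    funext Z
    have hd := det_val_ne_zero Z
    have h1 : matCoeff z 1 a b j 0 Z = matCoeff Z.val.adjugate 1 a b j 0 := by
      change Pi.evalRingHom (fun _ : HCx => ℂ) Z (matCoeff z 1 a b j 0) = _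
      rw [map_matCoeff, map_one]
      congr 1
      ext i c
      fin_cases i <;> fin_cases c <;> simp [z, coord, Matrix.adjugate_fin_two]
    have h2 : ((detUnit Z⁻¹ ^ k : ℂˣ) : ℂ) = Z.val.det ^ (-k) := by
      rw [detUnit, map_inv, inv_zpow', Units.val_zpow_eq_zpow_val]
      rfl
    rw [tFun_apply, Pi.mul_apply, h1, Pi.pow_apply, nZ_apply, inv_val_eq, matCoeff_smul, matCoeff,
      matCoeff, h2]
    simp only [zpow_zero, Units.val_one, mul_one]
    have h3 : (Z.val.det)⁻¹ ^ (a + b) * Z.val.det ^ (-k) = Z.val.det ^ (m + 3) := by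
      rw [inv_pow, ← zpow_natCast, ← zpow_natCast, ← _root_.zpow_neg, ← zpow_add₀ hd]
      congr 1
      push_cast
      omega
    rw [div_eq_iff (pow_ne_zero _ hd)]
    rw [pow_add] at h3
    linear_combination zcoeff j (rowPoly Z.val.adjugate 0 ^ a * rowPoly Z.val.adjugate 1 ^ b) * h3
  · -- multiplication by `g (Z⁻¹)`, for `g` polynomial, preserves the span on the left
    have key : ∀ g ∈ polyFun, ∀ h ∈ spanTN (fun p k => k ≤ -(p + 3)),
        ∃ h' ∈ spanTN (fun p k => k ≤ -(p + 3)), ∀ Z : HCx,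
          (h' : HCx → ℂ) Z = g Z⁻¹ * (h : HCx → ℂ) Z := by
      intro g hg
      induction hg using Algebra.adjoin_induction with
      | mem x hx =>
        obtain ⟨⟨r, c⟩, rfl⟩ := hx
        intro h hh
        have hmem : ∀ r c, zc r c * nInv * h ∈ spanTN (fun p k => k ≤ -(p + 3)) := by
          intro r c
          rw [mul_assoc, nInv_eq]
          refine zc_mul_mem_spanTN (R := fun p k => k + 1 ≤ -(p + 3)) r c
            (fun _ _ h => by omega) (fun _ _ h => by omega) ?_
          exact nUnit_zpow_mul_mem_spanTN _ (fun _ _ h => by omega) hh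
        have hval : ∀ r c Z, ((zc r c * nInv * h : Zh) : HCx → ℂ) Z =
            Z.val r c * (Z.val.det)⁻¹ * (h : HCx → ℂ) Z := fun _ _ _ => rfl
        have hcoord : ∀ Z : HCx, coord r c Z⁻¹ = (Z.val.det)⁻¹ * Z.val.adjugate r c := by
          intro Z
          rw [coord, inv_val_eq]
          rfl
        simp only [hcoord, Matrix.adjugate_fin_two]
        fin_cases r <;> fin_cases c
        · exact ⟨_, hmem 1 1, fun Z => by
            rw [hval]
            change _ = (Z.val.det)⁻¹ * Z.val 1 1 * _
            ring⟩
        · exact ⟨_, Submodule.neg_mem _ (hmem 0 1), fun Z => by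
            rw [NegMemClass.coe_neg, Pi.neg_apply, hval]
            change _ = (Z.val.det)⁻¹ * (-Z.val 0 1) * _
            ring⟩
        · exact ⟨_, Submodule.neg_mem _ (hmem 1 0), fun Z => by
            rw [NegMemClass.coe_neg, Pi.neg_apply, hval]
            change _ = (Z.val.det)⁻¹ * (-Z.val 1 0) * _
            ring⟩
        · exact ⟨_, hmem 0 0, fun Z => by
            rw [hval]
            change _ = (Z.val.det)⁻¹ * Z.val 0 0 * _
            ring⟩
      | algebraMap r => exact fun h hh => ⟨r • h, Submodule.smul_mem _ r hh, fun Z => rfl⟩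
      | add x y _ _ hx hy =>
        intro h hh
        obtain ⟨h1, hm1, e1⟩ := hx h hh
        obtain ⟨h2, hm2, e2⟩ := hy h hh
        refine ⟨h1 + h2, Submodule.add_mem _ hm1 hm2, fun Z => ?_⟩
        rw [Subalgebra.coe_add, Pi.add_apply, e1, e2, Pi.add_apply, add_mul]
      | mul x y _ _ hx hy =>
        intro h hh
        obtain ⟨h1, hm1, e1⟩ := hy h hh
        obtain ⟨h2, hm2, e2⟩ := hx h1 hm1
        refine ⟨h2, hm2, fun Z => ?_⟩
        rw [e2, e1, Pi.mul_apply, mul_assoc]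
    intro f hf
    have h0 : ((nUnit ^ (-3 : ℤ) : Zhˣ) : Zh) * 1 ∈ spanTN (fun p k => k ≤ -(p + 3)) := by
      rw [one_eq_tFun, mul_comm, tFun, matCoeff_mul_unit_zpow]
      exact tFun_mem_spanTN (by simp)
    obtain ⟨h', hm, e⟩ := key _ hf _ h0
    convert hm
    apply Subtype.ext
    funext Z
    rw [e, mul_one, nUnit_zpow_apply, inv_inv]
    have hd := det_val_ne_zero Z
    have hdi : (Z⁻¹ : HCx).val.det = (Z.val.det)⁻¹ := by
      rw [Matrix.coe_units_inv, Matrix.det_nonsing_inv, Ring.inverse_eq_inv']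
    rw [hdi, show (-3 : ℤ) = -((3 : ℕ) : ℤ) from rfl, _root_.zpow_neg, zpow_natCast,
      inv_pow, show (2 + 1 : ℕ) = 3 from rfl, div_inv_eq_mul, mul_assoc,
      mul_inv_cancel₀ (pow_ne_zero 3 hd), mul_one]

/-! ### Invariance -/

/-- A condition on pairs `(2l, k)` that is stable under the transitions between the spaces
`V(2l, k) = span {t^l_{n m} N^k}` which the translations and the quadratic vector fields induce. The
names of the fields refer to the direction in which the spin `l` changes. -/
structure IsLadderClosed (R : ℤ → ℤ → Prop) : Prop where
  translation_down : ∀ (p : ℕ) (k : ℤ), R (p + 1) k → (p : ℤ) + 2 + k ≠ 0 → R p k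
  translation_up : ∀ (p : ℕ) (k : ℤ), R p k → k ≠ 0 → R (p + 1) (k - 1)
  inversion_up : ∀ (p : ℕ) (k : ℤ), R p k → (p : ℤ) + k + 3 ≠ 0 → R (p + 1) k
  inversion_down : ∀ (p : ℕ) (k : ℤ), R (p + 1) k → k + 2 ≠ 0 → R p (k + 1)

theorem lie_block01_mem_spanTN {R : ℤ → ℤ → Prop} (hR : IsLadderClosed R) (β : HC) (a b : ℕ)
    (j k : ℤ) (h : R (a + b) k) : ⁅block 0 1 β, tFun a b j k⁆ ∈ spanTN R := by
  have hne : (a + b + 1 : ℂ) ≠ 0 := by exact_mod_cast Nat.succ_ne_zero (a + b)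
  have hu : k ≠ 0 → R ((a + b : ℕ) + 1) (k - 1) :=
    hR.translation_up (a + b) k (by push_cast; exact h)
  push_cast at hu
  have hA : ∀ j, (a * (a + b + 1 + k) : ℂ) • tFun (a - 1) b j k ∈ spanTN R := fun j =>
    smul_tFun_mem_spanTN fun hc => by
      obtain ⟨a, rfl⟩ := Nat.exists_eq_succ_of_ne_zero (Nat.cast_ne_zero.mp (left_ne_zero_of_mul hc))
      have h2 : (a : ℤ) + 1 + b + 1 + k ≠ 0 := by exact_mod_cast right_ne_zero_of_mul hc
      have h3 := hR.translation_down (a + b) k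
      push_cast at h3 h
      simp only [Nat.succ_eq_add_one, Nat.add_sub_cancel]
      exact h3 (by rwa [show (a : ℤ) + b + 1 = a + 1 + b by ring]) (by omega)
  have hB : ∀ j, (b * (a + b + 1 + k) : ℂ) • tFun a (b - 1) j k ∈ spanTN R := fun j =>
    smul_tFun_mem_spanTN fun hc => by
      obtain ⟨b, rfl⟩ := Nat.exists_eq_succ_of_ne_zero (Nat.cast_ne_zero.mp (left_ne_zero_of_mul hc))
      have h2 : (a : ℤ) + (b + 1) + 1 + k ≠ 0 := by exact_mod_cast right_ne_zero_of_mul hc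
      have h3 := hR.translation_down (a + b) k
      push_cast at h3 h
      simp only [Nat.succ_eq_add_one, Nat.add_sub_cancel]
      exact h3 (by rwa [add_assoc]) (by omega)
  have hA' : ∀ (c : ℂ) j, (k * c : ℂ) • tFun (a + 1) b j (k - 1) ∈ spanTN R := fun c j =>
    smul_tFun_mem_spanTN fun hc => by
      have := hu (Int.cast_ne_zero.mp (left_ne_zero_of_mul hc))
      push_cast
      rwa [show (a : ℤ) + 1 + b = a + b + 1 by ring]
  have hB' : ∀ (c : ℂ) j, (k * c : ℂ) • tFun a (b + 1) j (k - 1) ∈ spanTN R := fun c j =>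
    smul_tFun_mem_spanTN fun hc => by
      have := hu (Int.cast_ne_zero.mp (left_ne_zero_of_mul hc))
      push_cast
      rwa [← add_assoc]
  rw [← Submodule.smul_mem_iff _ hne, lie_block01_tFun]
  refine Submodule.neg_mem _ (Submodule.add_mem _ (Submodule.add_mem _ (Submodule.add_mem _ ?_ ?_)
    ?_) ?_) <;> refine Submodule.smul_mem _ _ ?_
  · exact Submodule.add_mem _ (hA _) (hB' _ _)
  · exact Submodule.sub_mem _ (hA _) (hB' _ _)
  · exact Submodule.sub_mem _ (hB _) (hA' _ _)
  · exact Submodule.add_mem _ (hB _) (hA' _ _)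

theorem lie_block10_mem_spanTN {R : ℤ → ℤ → Prop} (hR : IsLadderClosed R) (γ : HC) (a b : ℕ)
    (j k : ℤ) (h : R (a + b) k) : ⁅block 1 0 γ, tFun a b j k⁆ ∈ spanTN R := by
  have hne : (a + b + 1 : ℂ) ≠ 0 := by exact_mod_cast Nat.succ_ne_zero (a + b)
  have hu : ((a + b : ℕ) : ℤ) + k + 3 ≠ 0 → R ((a + b : ℕ) + 1) k :=
    hR.inversion_up (a + b) k (by push_cast; exact h)
  push_cast at hu
  have hA : ∀ j, (a * (k + 2) : ℂ) • tFun (a - 1) b j (k + 1) ∈ spanTN R := fun j =>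
    smul_tFun_mem_spanTN fun hc => by
      obtain ⟨a, rfl⟩ := Nat.exists_eq_succ_of_ne_zero (Nat.cast_ne_zero.mp (left_ne_zero_of_mul hc))
      have h2 : k + 2 ≠ 0 := by exact_mod_cast right_ne_zero_of_mul hc
      have h3 := hR.inversion_down (a + b) k
      push_cast at h3 h
      simp only [Nat.succ_eq_add_one, Nat.add_sub_cancel]
      exact h3 (by rwa [show (a : ℤ) + b + 1 = a + 1 + b by ring]) h2
  have hB : ∀ j, (b * (k + 2) : ℂ) • tFun a (b - 1) j (k + 1) ∈ spanTN R := fun j =>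
    smul_tFun_mem_spanTN fun hc => by
      obtain ⟨b, rfl⟩ := Nat.exists_eq_succ_of_ne_zero (Nat.cast_ne_zero.mp (left_ne_zero_of_mul hc))
      have h2 : k + 2 ≠ 0 := by exact_mod_cast right_ne_zero_of_mul hc
      have h3 := hR.inversion_down (a + b) k
      push_cast at h3 h
      simp only [Nat.succ_eq_add_one, Nat.add_sub_cancel]
      exact h3 (by rwa [add_assoc]) h2
  have hA' : ∀ (c : ℂ) j, ((a + b + k + 3) * c : ℂ) • tFun (a + 1) b j k ∈ spanTN R := fun c j =>
    smul_tFun_mem_spanTN fun hc => by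
      have := hu (by exact_mod_cast left_ne_zero_of_mul hc)
      push_cast
      rwa [show (a : ℤ) + 1 + b = a + b + 1 by ring]
  have hB' : ∀ (c : ℂ) j, ((a + b + k + 3) * c : ℂ) • tFun a (b + 1) j k ∈ spanTN R := fun c j =>
    smul_tFun_mem_spanTN fun hc => by
      have := hu (by exact_mod_cast left_ne_zero_of_mul hc)
      push_cast
      rwa [← add_assoc]
  rw [← Submodule.smul_mem_iff _ hne, lie_block10_tFun]
  refine Submodule.add_mem _ (Submodule.add_mem _ (Submodule.add_mem _ ?_ ?_) ?_) ?_ <;>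
    refine Submodule.smul_mem _ _ ?_
  · exact Submodule.add_mem _ (hA' _ _) (hB _)
  · exact Submodule.sub_mem _ (hA' _ _) (hB _)
  · exact Submodule.sub_mem _ (hB' _ _) (hA _)
  · exact Submodule.add_mem _ (hB' _ _) (hA _)

theorem lie_block00_mem_spanTN {R : ℤ → ℤ → Prop} (α : HC) (a b : ℕ) (j k : ℤ)
    (h : R (a + b) k) : ⁅block 0 0 α, tFun a b j k⁆ ∈ spanTN R := by
  have hm : ∀ (c : ℂ) j, c • tFun a b j k ∈ spanTN R := fun c j =>
    Submodule.smul_mem _ _ (tFun_mem_spanTN h)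
  rw [lie_block00_tFun]
  exact Submodule.neg_mem _ (Submodule.add_mem _ (Submodule.add_mem _ (hm _ _) (hm _ _)) (hm _ _))

theorem lie_block11_mem_spanTN {R : ℤ → ℤ → Prop} (δ : HC) (a b : ℕ) (j k : ℤ)
    (h : R (a + b) k) : ⁅block 1 1 δ, tFun a b j k⁆ ∈ spanTN R := by
  rw [lie_block11_tFun]
  refine Submodule.add_mem _ (Submodule.add_mem _ ?_ ?_) ?_
  · exact Submodule.smul_mem _ _ (tFun_mem_spanTN h)
  · refine smul_tFun_mem_spanTN fun hc => ?_
    have ha : a ≠ 0 := Nat.cast_ne_zero.mp (right_ne_zero_of_mul hc)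
    rwa [show ((a - 1 : ℕ) : ℤ) + (b + 1 : ℕ) = a + b by omega]
  · refine smul_tFun_mem_spanTN fun hc => ?_
    have hb : b ≠ 0 := Nat.cast_ne_zero.mp (right_ne_zero_of_mul hc)
    rwa [show ((a + 1 : ℕ) : ℤ) + (b - 1 : ℕ) = a + b by omega]

/-- The invariant subspace `spanTN R` for a condition `R` that is stable under the transitions. -/
def spanLie (R : ℤ → ℤ → Prop) (hR : IsLadderClosed R) : LieSubmodule ℂ gl2HC Zh where
  toSubmodule := spanTN R
  lie_mem := by
    intro X f hf
    refine map_mem_of_mem_spanTN (LieModule.toEnd ℂ gl2HC Zh X) ?_ hf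
    intro a b j k h
    rw [LieModule.toEnd_apply_apply, eq_sum_block X, add_lie, add_lie, add_lie]
    exact Submodule.add_mem _
      (Submodule.add_mem _ (lie_block00_mem_spanTN _ _ _ _ _ h)
        (lie_block01_mem_spanTN hR _ _ _ _ _ h))
      (Submodule.add_mem _ (lie_block10_mem_spanTN hR _ _ _ _ _ h)
        (lie_block11_mem_spanTN _ _ _ _ _ h))

/-! ### Invariant subspaces are spanned by matrix coefficients -/

/-- The functions `tN p i j k` with `i, j ≤ p` form a basis of `Zh`. -/
def tBasis : Module.Basis TIndex ℂ Zh :=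
  Module.Basis.mk linearIndependent_toZh (by
    rw [← spanTN_true]
    refine Submodule.span_mono ?_
    rintro _ ⟨p, i, j, k, hi, hj, -, rfl⟩
    exact ⟨⟨p, i, j, k, hi, hj⟩, rfl⟩)

theorem tBasis_apply (x : TIndex) : tBasis x = x.toZh := by
  rw [tBasis, Module.Basis.mk_apply]

theorem toZh_mem_of_repr_ne_zero (W : LieSubmodule ℂ gl2HC Zh) {f : Zh} (hf : f ∈ W) {x : TIndex}
    (hx : tBasis.repr f x ≠ 0) : x.toZh ∈ W := by
  refine mem_of_linearCombination_mem diagOp_toZh exists_diagEig_ne (W := W.toSubmodule)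
    (diagOp_mem W) (tBasis.repr f) ?_ hx
  have : TIndex.toZh = tBasis := funext fun x => (tBasis_apply x).symm
  rw [this, tBasis.linearCombination_repr]
  exact hf

theorem mem_of_forall_repr (W : LieSubmodule ℂ gl2HC Zh) {f : Zh}
    (h : ∀ x, tBasis.repr f x ≠ 0 → x.toZh ∈ W) : f ∈ W := by
  rw [← tBasis.linearCombination_repr f]
  refine W.toSubmodule.sum_mem fun x hx => W.toSubmodule.smul_mem _ ?_
  rw [tBasis_apply]
  exact h x (Finsupp.mem_support_iff.mp hx)

theorem lieSubmodule_le_iff {W W' : LieSubmodule ℂ gl2HC Zh} :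
    W ≤ W' ↔ ∀ x : TIndex, x.toZh ∈ W → x.toZh ∈ W' :=
  ⟨fun h _ hx => h hx, fun h _ hf =>
    mem_of_forall_repr W' fun x hx => h x (toZh_mem_of_repr_ne_zero W hf hx)⟩

theorem toZh_mem_sup {W W' : LieSubmodule ℂ gl2HC Zh} {x : TIndex} :
    x.toZh ∈ W ⊔ W' ↔ x.toZh ∈ W ∨ x.toZh ∈ W' := by
  refine ⟨fun h => ?_, fun h => h.elim (fun h => (le_sup_left : W ≤ W ⊔ W') h)
    (fun h => (le_sup_right : W' ≤ W ⊔ W') h)⟩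
  obtain ⟨w, hw, w', hw', e⟩ := LieSubmodule.mem_sup _ _ _ |>.mp h
  have h1 : tBasis.repr w x + tBasis.repr w' x = 1 := by
    rw [← Finsupp.add_apply, ← map_add, e, ← tBasis_apply, tBasis.repr_self,
      Finsupp.single_eq_same]
  by_cases h2 : tBasis.repr w x = 0
  · refine Or.inr (toZh_mem_of_repr_ne_zero W' hw' ?_)
    rw [h2, zero_add] at h1
    rw [h1]
    exact one_ne_zero
  · exact Or.inl (toZh_mem_of_repr_ne_zero W hw h2)

theorem toZh_mem_spanTN {R : ℤ → ℤ → Prop} {x : TIndex} : x.toZh ∈ spanTN R ↔ R x.p x.k := by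
  refine ⟨fun h => ?_, fun h => tN_mem_spanTN x.hi x.hj h⟩
  by_contra hx
  refine linearIndependent_toZh.notMem_span_image (s := {y | R y.p y.k}) hx ?_
  refine Submodule.span_mono ?_ h
  rintro _ ⟨p, i, j, k, hi, hj, hR, rfl⟩
  exact ⟨⟨p, i, j, k, hi, hj⟩, hR, rfl⟩

/-- An invariant subspace that contains a combination of two basis functions with different `k`
contains the first one if its coefficient is not zero. -/
theorem mem_left_of_add_mem (W : LieSubmodule ℂ gl2HC Zh) {a b a' b' j j' : ℕ} {k k' : ℤ}
    {c d : ℂ} (h : c • tFun a b j k + d • tFun a' b' j' k' ∈ W) (hj : j ≤ a + b)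
    (hj' : j' ≤ a' + b') (hk : k ≠ k') (hc : c ≠ 0) : tFun a b j k ∈ W := by
  let x : TIndex := ⟨a + b, a, j, k, by omega, hj⟩
  let y : TIndex := ⟨a' + b', a', j', k', by omega, hj'⟩
  have hx : tFun a b j k = tBasis x := by rw [tBasis_apply, tFun_eq_tN]; rfl
  have hy : tFun a' b' j' k' = tBasis y := by rw [tBasis_apply, tFun_eq_tN]; rfl
  have hxy : y ≠ x := fun e => hk (congrArg TIndex.k e).symm
  rw [hx, tBasis_apply]
  rw [hx, hy] at h
  refine toZh_mem_of_repr_ne_zero W h ?_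
  rw [map_add, map_smul, map_smul, tBasis.repr_self, tBasis.repr_self, Finsupp.add_apply,
    Finsupp.smul_apply, Finsupp.smul_apply, Finsupp.single_eq_same,
    Finsupp.single_eq_of_ne hxy.symm]
  simpa using hc

/-! ### The transitions inside an invariant subspace -/

section

variable (W : LieSubmodule ℂ gl2HC Zh)

theorem mem_of_smul_mem_lieSubmodule {c : ℂ} (hc : c ≠ 0) {f : Zh} (h : c • f ∈ W) : f ∈ W :=
  (W.toSubmodule.smul_mem_iff hc).mp h

/-- The operators of the upper left block reach every `j` from every other one. -/
theorem tFun_mem_row {a b j : ℕ} {k : ℤ} (hj : j ≤ a + b) (h : tFun a b j k ∈ W) (j' : ℕ) :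
    tFun a b j' k ∈ W := by
  have h0 : tFun a b (0 : ℕ) k ∈ W := by
    induction j with
    | zero => exact h
    | succ j ih =>
      refine ih (by omega) ?_
      have h1 := W.lie_mem (x := block 0 0 (unitM 0 1)) h
      rw [lie_row_pred] at h1
      have hc : (-(a + b - ((j + 1 : ℕ) : ℤ) + 1) : ℂ) ≠ 0 := by
        have h3 : -((a : ℤ) + b - (j + 1 : ℕ) + 1) ≠ 0 := by omega
        exact_mod_cast h3
      simpa using mem_of_smul_mem_lieSubmodule W hc h1
  induction j' with
  | zero => exact h0
  | succ j' ih =>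
    have h1 := W.lie_mem (x := block 0 0 (unitM 1 0)) ih
    rw [lie_row_succ] at h1
    have hc : (-(((j' : ℕ) : ℤ) + 1) : ℂ) ≠ 0 := by
      have h3 : -((j' : ℤ) + 1) ≠ 0 := by omega
      exact_mod_cast h3
    simpa using mem_of_smul_mem_lieSubmodule W hc h1

/-- The operators of the lower right block reach every `(a, b)` with the same sum. -/
theorem tFun_mem_col {a b : ℕ} {j k : ℤ} (h : tFun a b j k ∈ W) (a' b' : ℕ)
    (hab : a' + b' = a + b) : tFun a' b' j k ∈ W := by
  have h0 : tFun 0 (a + b) j k ∈ W := by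
    induction a generalizing b with
    | zero => rwa [zero_add]
    | succ a ih =>
      have h1 := W.lie_mem (x := block 1 1 (unitM 1 0)) h
      rw [lie_col_pred] at h1
      have h2 := ih (mem_of_smul_mem_lieSubmodule W (Nat.cast_ne_zero.mpr a.succ_ne_zero) h1) (by omega)
      rwa [show a + 1 + b = a + (b + 1) by omega]
  rw [← hab] at h0
  clear hab h
  induction a' generalizing b' with
  | zero => rwa [zero_add] at h0
  | succ a' ih =>
    have h1 := W.lie_mem (x := block 1 1 (unitM 0 1))
      (ih (b' + 1) (by rwa [show a' + (b' + 1) = a' + 1 + b' by omega]))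
    rw [lie_col_succ] at h1
    exact mem_of_smul_mem_lieSubmodule W (Nat.cast_ne_zero.mpr b'.succ_ne_zero) h1

/-- The condition on `(2l, k)` that `W` contains the functions `t^l_{n m} N^k`. It is enough to ask
this for one of them (`ladderRel_iff`). -/
def ladderRel (p k : ℤ) : Prop := tFun 0 p.toNat 0 k ∈ W

theorem ladderRel_iff (x : TIndex) : ladderRel W x.p x.k ↔ x.toZh ∈ W := by
  have hx := x.hi
  have hj := x.hj
  rw [ladderRel, Int.toNat_natCast, x.toZh_eq]
  refine ⟨fun h => ?_, fun h => ?_⟩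
  · exact tFun_mem_row W (j := 0) (Nat.zero_le _)
      (tFun_mem_col W h x.i (x.p - x.i) (by omega)) x.j
  · exact tFun_mem_col W (tFun_mem_row W (by omega) h 0) 0 x.p (by omega)

theorem isLadderClosed_ladderRel : IsLadderClosed (ladderRel W) where
  translation_down := by
    intro p k h hne
    rw [ladderRel, show ((p : ℤ) + 1).toNat = p + 1 by omega] at h
    rw [ladderRel, Int.toNat_natCast]
    have h1 := W.toSubmodule.smul_mem ((0 : ℕ) + (p + 1 : ℕ) + 1 : ℂ)
      (W.lie_mem (x := block 0 1 (unitM 1 1)) h)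
    rw [lie_block01_tFun] at h1
    simp only [unitM, Matrix.single_apply] at h1
    simp at h1
    have h2 : ((p + 1) * (p + 1 + 1 + k) : ℂ) • tFun 0 p (0 : ℕ) k +
        (k : ℂ) • tFun 1 (p + 1) (1 : ℕ) (k - 1) ∈ W := by
      have h3 := W.neg_mem h1
      rw [neg_add, neg_neg, neg_neg, add_comm] at h3
      exact_mod_cast h3
    refine mem_left_of_add_mem W (j := 0) (j' := 1) h2 (by omega) (by omega) (by omega) ?_
    have h3 : ((p : ℤ) + 1) * (p + 1 + 1 + k) ≠ 0 := mul_ne_zero (by omega) (by omega)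
    exact_mod_cast h3
  translation_up := by
    intro p k h hne
    rw [ladderRel, Int.toNat_natCast] at h
    rw [ladderRel, show ((p : ℤ) + 1).toNat = p + 1 by omega]
    have h1 := W.toSubmodule.smul_mem ((0 : ℕ) + p + 1 : ℂ)
      (W.lie_mem (x := block 0 1 (unitM 0 0)) h)
    rw [lie_block01_tFun] at h1
    simp only [unitM, Matrix.single_apply] at h1
    simp at h1
    refine mem_of_smul_mem_lieSubmodule W (c := k * (p + 1)) ?_ h1
    have h3 : k * (p + 1) ≠ 0 := mul_ne_zero hne (by omega)
    exact_mod_cast h3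
  inversion_up := by
    intro p k h hne
    rw [ladderRel, Int.toNat_natCast] at h
    rw [ladderRel, show ((p : ℤ) + 1).toNat = p + 1 by omega]
    have h1 := W.toSubmodule.smul_mem ((0 : ℕ) + p + 1 : ℂ)
      (W.lie_mem (x := block 1 0 (unitM 1 1)) h)
    rw [lie_block10_tFun] at h1
    simp only [unitM, Matrix.single_apply] at h1
    simp at h1
    refine mem_of_smul_mem_lieSubmodule W (c := (p + k + 3) * (p + 1)) ?_ h1
    have h3 : ((p : ℤ) + k + 3) * (p + 1) ≠ 0 := mul_ne_zero hne (by omega)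
    exact_mod_cast h3
  inversion_down := by
    intro p k h hne
    rw [ladderRel, show ((p : ℤ) + 1).toNat = p + 1 by omega] at h
    rw [ladderRel, Int.toNat_natCast]
    have h1 := W.toSubmodule.smul_mem ((0 : ℕ) + (p + 1 : ℕ) + 1 : ℂ)
      (W.lie_mem (x := block 1 0 (unitM 0 0)) h)
    rw [lie_block10_tFun] at h1
    simp only [unitM, Matrix.single_apply] at h1
    simp at h1
    have h2 : ((p + 1) * (k + 2) : ℂ) • tFun 0 p (0 : ℕ) (k + 1) +
        (p + 1 + k + 3 : ℂ) • tFun 1 (p + 1) (1 : ℕ) k ∈ W := by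
      rw [add_comm]
      exact_mod_cast h1
    refine mem_left_of_add_mem W (j := 0) (j' := 1) h2 (by omega) (by omega) (by omega) ?_
    have h3 : ((p : ℤ) + 1) * (k + 2) ≠ 0 := mul_ne_zero (by omega) hne
    exact_mod_cast h3

end

/-! ### The five strata -/

/-- The conditions on `(2l, k)` that define `Zh⁺`, `Zh₂⁻`, `J₂`, `I₂⁺` and `I₂⁻`, in this order. -/
def generatedRel : Fin 5 → ℤ → ℤ → Prop :=
  ![fun _ k => 0 ≤ k, fun p k => k ≤ -(p + 3), fun p k => -(p + 1) ≤ k ∧ k ≤ -2,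
    fun p k => -(p + 1) ≤ k, fun _ k => k ≤ -2]

/-- The strongly connected components of the transition graph on the pairs `(2l, k)`: the regions
`k ≥ 0`, `2l + k ≤ -3`, (`k ≤ -2` and `2l + k ≥ -1`), `k = -1`, and `2l + k = -2`, numbered such that
the `r`-th one generates the `r`-th of the five subspaces. -/
def stratum (p k : ℤ) : Fin 5 :=
  if 0 ≤ k then 0 else if k = -1 then 3 else if p + k ≤ -3 then 1 else
    if p + k = -2 then 4 else 2

/-- The strata that make up the invariant subspace generated by a stratum. -/
def below : Fin 5 → Finset (Fin 5) := ![{0}, {1}, {2}, {0, 2, 3}, {1, 2, 4}]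

theorem generatedRel_iff (r : Fin 5) (p : ℕ) (k : ℤ) :
    generatedRel r p k ↔ stratum p k ∈ below r := by
  unfold stratum
  split_ifs <;> fin_cases r <;> simp [generatedRel, below] <;> omega

theorem isLadderClosed_generatedRel (r : Fin 5) : IsLadderClosed (generatedRel r) := by
  fin_cases r <;> constructor <;> intro p k <;> simp [generatedRel] <;> omega

/-- A point of each stratum. -/
def stratumRep : Fin 5 → TIndex :=
  ![⟨0, 0, 0, 0, le_rfl, le_rfl⟩, ⟨0, 0, 0, -3, le_rfl, le_rfl⟩,
    ⟨1, 0, 0, -2, zero_le_one, zero_le_one⟩, ⟨0, 0, 0, -1, le_rfl, le_rfl⟩,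
    ⟨0, 0, 0, -2, le_rfl, le_rfl⟩]

theorem stratum_stratumRep (r : Fin 5) : stratum (stratumRep r).p (stratumRep r).k = r := by
  fin_cases r <;> simp [stratumRep, stratum]

section

variable {R : ℤ → ℤ → Prop} (hR : IsLadderClosed R)
include hR

theorem IsLadderClosed.spin_up {p p' : ℕ} {k : ℤ} (h : R p k) (hp : p ≤ p')
    (hq : -2 ≤ p + k ∨ p' + k ≤ -3) : R p' k := by
  induction p', hp using Nat.le_induction with
  | base => exact h
  | succ m hm ih =>
    have := hR.inversion_up m k (ih (by omega)) (by push_cast at hq; omega)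
    exact_mod_cast this

theorem IsLadderClosed.spin_down {p p' : ℕ} {k : ℤ} (h : R p k) (hp : p' ≤ p)
    (hq : -1 ≤ p' + k ∨ p + k ≤ -2) : R p' k := by
  induction p, hp using Nat.le_induction with
  | base => exact h
  | succ m hm ih =>
    refine ih (hR.translation_down m k (by exact_mod_cast h) ?_) ?_ <;>
      push_cast at hq <;> omega

theorem IsLadderClosed.exponent_down {p p' : ℕ} {k k' : ℤ} (h : R p k) (hp : p ≤ p')
    (e : p + k = p' + k') (hk : k ≤ -1 ∨ 0 ≤ k') : R p' k' := by
  induction p', hp using Nat.le_induction generalizing k' with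
  | base =>
    obtain rfl : k = k' := by omega
    exact h
  | succ m hm ih =>
    have := hR.translation_up m (k' + 1) (ih (by push_cast at e; omega) (by omega))
      (by push_cast at e; omega)
    rw [add_sub_cancel_right] at this
    exact_mod_cast this

theorem IsLadderClosed.exponent_up {p p' : ℕ} {k k' : ℤ} (h : R p k) (hp : p' ≤ p)
    (e : p + k = p' + k') (hk : -1 ≤ k ∨ k' ≤ -2) : R p' k' := by
  induction p, hp using Nat.le_induction generalizing k with
  | base =>
    obtain rfl : k = k' := by omega
    exact h
  | succ m hm ih =>
    exact ih (k := k + 1) (hR.inversion_down m k (by exact_mod_cast h)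
      (by push_cast at e; omega)) (by push_cast at e; omega) (by omega)

/-- Each point of a stratum is connected to its representative. -/
theorem IsLadderClosed.to_stratumRep {p : ℕ} {k : ℤ} (h : R p k) :
    R (stratumRep (stratum p k)).p (stratumRep (stratum p k)).k := by
  unfold stratum
  split_ifs with h1 h2 h3 h4
  · have h5 : R (p + k.toNat : ℕ) 0 := hR.exponent_down h (by omega) (by omega) (by omega)
    exact hR.spin_down (p' := 0) (k := 0) h5 (by omega) (by omega)
  · subst h2
    exact hR.spin_down (p' := 0) (k := -1) h (by omega) (by omega)
  · have h5 : R (-3 - k).toNat k := hR.spin_up h (by omega) (by omega)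
    exact hR.exponent_up (p' := 0) (k' := -3) h5 (by omega) (by omega) (by omega)
  · exact hR.exponent_up (p' := 0) (k' := -2) h (by omega) (by omega) (by omega)
  · have h5 : R (-1 - k).toNat k := hR.spin_down h (by omega) (by omega)
    exact hR.exponent_up (p' := 1) (k' := -2) h5 (by omega) (by omega) (by omega)

/-- The representative of a stratum is connected to each point of the strata below. -/
theorem IsLadderClosed.of_stratumRep {r : Fin 5}
    (h : R (stratumRep r).p (stratumRep r).k) {p : ℕ} {k : ℤ}
    (hr : generatedRel r p k) : R p k := by
  fin_cases r
  · have h1 : R (0 : ℕ) 0 := h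
    have hr : 0 ≤ k := hr
    have h5 : R (p + k.toNat : ℕ) 0 := hR.spin_up h1 (by omega) (by omega)
    exact hR.exponent_up h5 (by omega) (by omega) (by omega)
  · have h1 : R (0 : ℕ) (-3) := h
    have hr : k ≤ -(p + 3) := hr
    have h5 : R (-3 - k).toNat k := hR.exponent_down h1 (by omega) (by omega) (by omega)
    exact hR.spin_down h5 (by omega) (by omega)
  · have h1 : R (1 : ℕ) (-2) := h
    have hr : -(p + 1) ≤ k ∧ k ≤ -2 := hr
    have h5 : R (-1 - k).toNat k := hR.exponent_down h1 (by omega) (by omega) (by omega)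
    exact hR.spin_up h5 (by omega) (by omega)
  · have h1 : R (0 : ℕ) (-1) := h
    have hr : -(p + 1) ≤ k := hr
    by_cases hk : 0 ≤ k
    · have h5 : R (p + k.toNat + 1 : ℕ) (-1) := hR.spin_up h1 (by omega) (by omega)
      exact hR.exponent_up h5 (by omega) (by omega) (by omega)
    · have h5 : R (-1 - k).toNat k := hR.exponent_down h1 (by omega) (by omega) (by omega)
      exact hR.spin_up h5 (by omega) (by omega)
  · have h1 : R (0 : ℕ) (-2) := h
    have hr : k ≤ -2 := hr
    have h5 : R (-2 - k).toNat k := hR.exponent_down h1 (by omega) (by omega) (by omega)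
    by_cases hk : -2 ≤ p + k
    · exact hR.spin_up h5 (by omega) (by omega)
    · exact hR.spin_down h5 (by omega) (by omega)

end

/-! ### The lattice of invariant subspaces -/

/-- The invariant subspaces `Zh⁺`, `Zh₂⁻`, `J₂`, `I₂⁺` and `I₂⁻`, in this order. -/
def stratumModule (r : Fin 5) : LieSubmodule ℂ gl2HC Zh :=
  spanLie (generatedRel r) (isLadderClosed_generatedRel r)

/-- The invariant subspace `W` contains the stratum `r`. -/
def HasStratum (W : LieSubmodule ℂ gl2HC Zh) (r : Fin 5) : Prop := (stratumRep r).toZh ∈ W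

variable {V W : LieSubmodule ℂ gl2HC Zh}

theorem toZh_mem_stratumModule {r : Fin 5} {x : TIndex} :
    x.toZh ∈ stratumModule r ↔ generatedRel r x.p x.k :=
  toZh_mem_spanTN

theorem hasStratum_stratumModule {r s : Fin 5} : HasStratum (stratumModule r) s ↔ s ∈ below r := by
  rw [HasStratum, toZh_mem_stratumModule, generatedRel_iff, stratum_stratumRep]

theorem stratumModule_le_iff {r : Fin 5} : stratumModule r ≤ W ↔ HasStratum W r := by
  refine ⟨fun h => h ?_, fun h => lieSubmodule_le_iff.mpr fun x hx => ?_⟩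
  · exact hasStratum_stratumModule.mpr (by fin_cases r <;> simp [below])
  · rw [HasStratum, ← ladderRel_iff] at h
    rw [← ladderRel_iff]
    exact (isLadderClosed_ladderRel W).of_stratumRep h (toZh_mem_stratumModule.mp hx)

theorem toZh_mem_iff_hasStratum {x : TIndex} : x.toZh ∈ W ↔ HasStratum W (stratum x.p x.k) := by
  refine ⟨fun h => ?_, fun h => stratumModule_le_iff.mpr h ?_⟩
  · rw [← ladderRel_iff] at h
    rw [HasStratum, ← ladderRel_iff]
    exact (isLadderClosed_ladderRel W).to_stratumRep h
  · rw [toZh_mem_stratumModule, generatedRel_iff]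
    generalize stratum x.p x.k = r
    fin_cases r <;> simp [below]

/-- An invariant subspace is determined by the strata that it contains. -/
theorem le_iff_hasStratum : V ≤ W ↔ ∀ r, HasStratum V r → HasStratum W r :=
  ⟨fun h _ hr => h hr, fun h => lieSubmodule_le_iff.mpr fun _ hx =>
    toZh_mem_iff_hasStratum.mpr (h _ (toZh_mem_iff_hasStratum.mp hx))⟩

theorem hasStratum_sup {r : Fin 5} : HasStratum (V ⊔ W) r ↔ HasStratum V r ∨ HasStratum W r :=
  toZh_mem_sup

theorem hasStratum_inf {r : Fin 5} : HasStratum (V ⊓ W) r ↔ HasStratum V r ∧ HasStratum W r :=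
  LieSubmodule.mem_inf _ _ _

theorem hasStratum_top (r : Fin 5) : HasStratum ⊤ r := LieSubmodule.mem_top _

theorem not_hasStratum_bot (r : Fin 5) : ¬ HasStratum ⊥ r := fun h =>
  (stratumRep r).toZh_ne_zero ((LieSubmodule.mem_bot _).mp h)

theorem eq_top_iff_hasStratum : W = ⊤ ↔ ∀ r, HasStratum W r := by
  rw [eq_top_iff, le_iff_hasStratum]
  exact ⟨fun h r => h r (hasStratum_top r), fun h r _ => h r⟩

theorem eq_bot_iff_hasStratum : W = ⊥ ↔ ∀ r, ¬ HasStratum W r := by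
  rw [eq_bot_iff, le_iff_hasStratum]
  exact ⟨fun h r hr => not_hasStratum_bot r (h r hr), fun h r hr => absurd hr (h r)⟩

theorem disjoint_of_hasStratum (h : ∀ r, HasStratum V r → ¬ HasStratum W r) : Disjoint V W := by
  rw [disjoint_iff, eq_bot_iff_hasStratum]
  intro r hr
  exact h r (hasStratum_inf.mp hr).1 (hasStratum_inf.mp hr).2

/-- The proper nonzero invariant subspaces are the sums of the five subspaces that do not involve
both `I₂⁻` and `I₂⁺`. -/
theorem ne_bot_and_ne_top_iff (W : LieSubmodule ℂ gl2HC Zh) :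
    (W ≠ ⊥ ∧ W ≠ ⊤) ↔ ∃ S : Set (LieSubmodule ℂ gl2HC Zh),
      S ⊆ {stratumModule 0, stratumModule 1, stratumModule 4, stratumModule 3, stratumModule 2} ∧
      S.Nonempty ∧ ¬ (stratumModule 4 ∈ S ∧ stratumModule 3 ∈ S) ∧ W = sSup S := by
  have hall : ∀ r, stratumModule r ∈ ({stratumModule 0, stratumModule 1, stratumModule 4,
      stratumModule 3, stratumModule 2} : Set (LieSubmodule ℂ gl2HC Zh)) := by
    intro r
    fin_cases r <;> simp
  constructor
  · rintro ⟨hbot, htop⟩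
    refine ⟨stratumModule '' {r | HasStratum W r}, ?_, ?_, ?_, ?_⟩
    · rintro _ ⟨r, -, rfl⟩
      exact hall r
    · by_contra h
      rw [Set.image_nonempty, Set.not_nonempty_iff_eq_empty] at h
      exact hbot (eq_bot_iff_hasStratum.mpr fun r hr => (h ▸ hr : r ∈ (∅ : Set (Fin 5))))
    · rintro ⟨⟨r, hr, e⟩, ⟨s, hs, e'⟩⟩
      have h4 : stratumModule 4 ≤ W := e ▸ stratumModule_le_iff.mpr hr
      have h3 : stratumModule 3 ≤ W := e' ▸ stratumModule_le_iff.mpr hs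
      refine htop (eq_top_iff_hasStratum.mpr fun t => ?_)
      have ht : t ∈ below 4 ∨ t ∈ below 3 := by revert t; decide
      rcases ht with ht | ht
      · exact h4 (hasStratum_stratumModule.mpr ht)
      · exact h3 (hasStratum_stratumModule.mpr ht)
    · apply le_antisymm
      · rw [le_iff_hasStratum]
        intro r hr
        exact stratumModule_le_iff.mp (le_sSup ⟨r, hr, rfl⟩)
      · refine sSup_le ?_
        rintro _ ⟨r, hr, rfl⟩
        exact stratumModule_le_iff.mpr hr
  · rintro ⟨S, hS, ⟨U, hU⟩, hnot, rfl⟩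
    have hr : ∀ U ∈ S, ∃ r, U = stratumModule r := by
      intro U hU
      have := hS hU
      simp only [Set.mem_insert_iff, Set.mem_singleton_iff] at this
      rcases this with h | h | h | h | h
      exacts [⟨0, h⟩, ⟨1, h⟩, ⟨4, h⟩, ⟨3, h⟩, ⟨2, h⟩]
    constructor
    · intro h
      obtain ⟨r, rfl⟩ := hr U hU
      exact not_hasStratum_bot r (h ▸ stratumModule_le_iff.mp (le_sSup hU))
    · have key : ∀ t u v : Fin 5, (∀ r, r ≠ t → r ∈ below u ∨ r ∈ below v) → t ∉ below u →
          t ∉ below v → stratumModule t ∉ S → sSup S ≠ ⊤ := by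
        intro t u v hle hu hv hmem htop
        have hsup : sSup S ≤ stratumModule u ⊔ stratumModule v := by
          refine sSup_le fun U hU => ?_
          obtain ⟨r, rfl⟩ := hr U hU
          rw [stratumModule_le_iff, hasStratum_sup, hasStratum_stratumModule,
            hasStratum_stratumModule]
          exact hle r fun e => hmem (e ▸ hU)
        have h1 := le_iff_hasStratum.mp hsup t (htop ▸ hasStratum_top t)
        rw [hasStratum_sup, hasStratum_stratumModule, hasStratum_stratumModule] at h1
        exact h1.elim hu hv
      by_cases h4 : stratumModule 4 ∈ S
      · exact key 3 4 0 (by decide) (by decide) (by decide) fun h3 => hnot ⟨h4, h3⟩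
      · exact key 4 3 1 (by decide) (by decide) (by decide) h4

/-! ### Irreducible modules with a common cover -/

section Schur

variable {K L M M₁ M₂ : Type*} [CommRing K] [LieRing L]
  [AddCommGroup M] [Module K M] [LieRingModule L M]
  [AddCommGroup M₁] [Module K M₁] [LieRingModule L M₁]
  [AddCommGroup M₂] [Module K M₂] [LieRingModule L M₂]

/-- Two surjections with the same kernel have isomorphic targets. -/
theorem exists_equiv_of_surjective (f : M →ₗ⁅K,L⁆ M₁) (g : M →ₗ⁅K,L⁆ M₂)
    (hf : Function.Surjective f) (hg : Function.Surjective g) (h : ∀ u, f u = 0 ↔ g u = 0) :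
    ∃ e : M₁ ≃ₗ⁅K,L⁆ M₂, ∀ u, e (f u) = g u := by
  have hker : LinearMap.ker (f : M →ₗ[K] M₁) = LinearMap.ker (g : M →ₗ[K] M₂) := by
    ext u
    exact h u
  let e : M₁ ≃ₗ[K] M₂ := ((f : M →ₗ[K] M₁).quotKerEquivOfSurjective hf).symm.trans
    ((Submodule.quotEquivOfEq _ _ hker).trans
      ((g : M →ₗ[K] M₂).quotKerEquivOfSurjective hg))
  have he : ∀ u, e (f u) = g u := by
    intro u
    have h1 : ((f : M →ₗ[K] M₁).quotKerEquivOfSurjective hf).symm (f u) =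
        Submodule.Quotient.mk u := by
      rw [LinearEquiv.symm_apply_eq]
      rfl
    change ((g : M →ₗ[K] M₂).quotKerEquivOfSurjective hg) (Submodule.quotEquivOfEq _ _ hker
      (((f : M →ₗ[K] M₁).quotKerEquivOfSurjective hf).symm (f u))) = g u
    rw [h1]
    rfl
  refine ⟨{ e with map_lie' := ?_ }, he⟩
  intro x m
  obtain ⟨u, rfl⟩ := hf m
  change e ⁅x, f u⁆ = ⁅x, e (f u)⁆
  rw [← LieModuleHom.map_lie, he, he, LieModuleHom.map_lie]

/-- If the kernel of a surjection onto an irreducible module is contained in the kernel of a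
surjection onto a nonzero module, then the targets are isomorphic. -/
theorem exists_equiv_of_isIrreducible [LieModule.IsIrreducible K L M₁] [Nontrivial M₂]
    (f : M →ₗ⁅K,L⁆ M₁) (g : M →ₗ⁅K,L⁆ M₂) (hf : Function.Surjective f)
    (hg : Function.Surjective g) (h : ∀ u, f u = 0 → g u = 0) :
    ∃ e : M₁ ≃ₗ⁅K,L⁆ M₂, ∀ u, e (f u) = g u := by
  refine exists_equiv_of_surjective f g hf hg fun u => ⟨h u, fun hu => ?_⟩
  rcases IsSimpleOrder.eq_bot_or_eq_top (g.ker.map f) with h1 | h1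
  · have : f u ∈ g.ker.map f := (LieSubmodule.mem_map _).mpr ⟨u, hu, rfl⟩
    rw [h1] at this
    exact (LieSubmodule.mem_bot _).mp this
  · obtain ⟨y, hy⟩ := exists_ne (0 : M₂)
    obtain ⟨v, rfl⟩ := hg y
    have : f v ∈ g.ker.map f := h1 ▸ LieSubmodule.mem_top _
    obtain ⟨w, hw, hwv⟩ := (LieSubmodule.mem_map _).mp this
    have h2 : g (v - w) = 0 := h _ (by rw [map_sub, hwv, sub_self])
    rw [map_sub, LieModuleHom.mem_ker.mp hw, sub_zero] at h2
    exact absurd h2 hy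

theorem surjective_of_isIrreducible [LieModule.IsIrreducible K L M₁] (f : M →ₗ⁅K,L⁆ M₁) {u : M}
    (hu : f u ≠ 0) : Function.Surjective f := by
  rw [← LieModuleHom.range_eq_top]
  refine (IsSimpleOrder.eq_bot_or_eq_top f.range).resolve_left fun h => hu ?_
  have : f u ∈ f.range := (LieModuleHom.mem_range _ _).mpr ⟨u, rfl⟩
  rw [h] at this
  exact (LieSubmodule.mem_bot _).mp this

end Schur

/-! ### Irreducible subquotients -/

variable {V W : LieSubmodule ℂ gl2HC Zh}

/-- A subquotient `V / (V ∩ W)` to which `V` contributes exactly one stratum is irreducible. -/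
theorem isIrreducible_of_surjective {M : Type*} [AddCommGroup M] [Module ℂ M]
    [LieRingModule gl2HC M] (π : V →ₗ⁅ℂ,gl2HC⁆ M) (hπ : Function.Surjective π)
    (hker : ∀ v : V, π v = 0 ↔ (v : Zh) ∈ W) (r : Fin 5) (hV : HasStratum V r)
    (hW : ¬ HasStratum W r) (h : ∀ s, HasStratum V s → ¬ HasStratum W s → s = r) :
    LieModule.IsIrreducible ℂ gl2HC M := by
  have : Nontrivial M := ⟨π ⟨_, hV⟩, 0, fun h0 => hW ((hker _).mp h0)⟩
  refine LieModule.IsIrreducible.mk fun N hN => ?_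
  -- the preimage of `N` in `V`, as a subspace of `Zh`
  let N' : LieSubmodule ℂ gl2HC Zh := (N.comap π).map V.incl
  have hN' : ∀ v : V, (v : Zh) ∈ N' ↔ π v ∈ N := by
    intro v
    refine ⟨fun hv => ?_, fun hv => (LieSubmodule.mem_map _).mpr ⟨v, hv, rfl⟩⟩
    obtain ⟨w, hw, e⟩ := (LieSubmodule.mem_map _).mp hv
    obtain rfl : w = v := Subtype.ext e
    exact hw
  have hle : N' ≤ V := by
    intro f hf
    obtain ⟨w, -, rfl⟩ := (LieSubmodule.mem_map _).mp hf
    exact w.2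
  have hr : HasStratum N' r := by
    by_contra hr
    have hNW : N' ≤ W := le_iff_hasStratum.mpr fun s hs => by
      by_contra hs'
      exact hr (h s (hle hs) hs' ▸ hs)
    refine hN ((LieSubmodule.eq_bot_iff _).mpr fun m hm => ?_)
    obtain ⟨v, rfl⟩ := hπ m
    exact (hker v).mpr (hNW ((hN' v).mpr hm))
  have hVle : V ≤ N' ⊔ W := le_iff_hasStratum.mpr fun s hs => hasStratum_sup.mpr <| by
    by_cases hs' : HasStratum W s
    · exact Or.inr hs'
    · exact Or.inl (h s hs hs' ▸ hr)
  refine eq_top_iff.mpr fun m _ => ?_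
  obtain ⟨v, rfl⟩ := hπ m
  obtain ⟨n, hn, w, hw, e⟩ := (LieSubmodule.mem_sup _ _ _).mp (hVle v.2)
  have hwV : w ∈ V := by
    rw [show w = v - n by rw [← e]; abel]
    exact V.toSubmodule.sub_mem v.2 (hle hn)
  have hv : v = ⟨n, hle hn⟩ + ⟨w, hwV⟩ := Subtype.ext e.symm
  rw [hv, map_add, (hker ⟨w, hwV⟩).mpr hw, add_zero]
  exact (hN' ⟨n, hle hn⟩).mp hn

theorem mk_subQuot_eq_zero {v : V} :
    LieSubmodule.Quotient.mk' (LieSubmodule.comap V.incl W) v = 0 ↔ (v : Zh) ∈ W :=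
  LieSubmodule.Quotient.mk_eq_zero _

theorem isIrreducible_subQuot (r : Fin 5) (hV : HasStratum V r) (hW : ¬ HasStratum W r)
    (h : ∀ s, HasStratum V s → ¬ HasStratum W s → s = r) :
    LieModule.IsIrreducible ℂ gl2HC (SubQuot V W) :=
  isIrreducible_of_surjective _ (LieSubmodule.Quotient.surjective_mk' _)
    (fun _ => mk_subQuot_eq_zero) r hV hW h

theorem isIrreducible_submodule (r : Fin 5) (hV : HasStratum V r)
    (h : ∀ s, HasStratum V s → s = r) : LieModule.IsIrreducible ℂ gl2HC V :=
  isIrreducible_of_surjective (W := ⊥) (LieModuleHom.id : V →ₗ⁅ℂ,gl2HC⁆ V)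
    Function.surjective_id (fun v => by simp) r hV (not_hasStratum_bot r) fun s hs _ => h s hs

theorem surjective_mk_comp_incl {U : LieSubmodule ℂ gl2HC Zh} (h : U ⊔ W = ⊤) :
    Function.Surjective ((LieSubmodule.Quotient.mk' W).comp U.incl) := by
  intro q
  obtain ⟨f, rfl⟩ := LieSubmodule.Quotient.surjective_mk' W q
  obtain ⟨u, hu, w, hw, rfl⟩ := (LieSubmodule.mem_sup _ _ _).mp
    (h ▸ LieSubmodule.mem_top f : f ∈ U ⊔ W)
  refine ⟨⟨u, hu⟩, ?_⟩
  rw [map_add, (LieSubmodule.Quotient.mk_eq_zero W).mpr hw, add_zero]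
  rfl

theorem isIrreducible_quotient (r : Fin 5) (hW : ¬ HasStratum W r)
    (h : ∀ s, ¬ HasStratum W s → s = r) : LieModule.IsIrreducible ℂ gl2HC (Zh ⧸ W) :=
  isIrreducible_of_surjective (W := W) ((LieSubmodule.Quotient.mk' W).comp
    (⊤ : LieSubmodule ℂ gl2HC Zh).incl) (surjective_mk_comp_incl (top_sup_eq _))
    (fun _ => LieSubmodule.Quotient.mk_eq_zero W) r (hasStratum_top r) hW fun s _ => h s

/-- An identity `U / U' = Zh / W` induced by the inclusion of `U`. -/
theorem exists_subQuot_equiv {U U' : LieSubmodule ℂ gl2HC Zh} (hsup : U ⊔ W = ⊤)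
    (h1 : U' ≤ W) (h2 : U ⊓ W ≤ U') :
    ∃ e : SubQuot U U' ≃ₗ⁅ℂ, gl2HC⁆ (Zh ⧸ W),
      ∀ x : U, e (LieSubmodule.Quotient.mk x) = LieSubmodule.Quotient.mk (x : Zh) := by
  refine exists_equiv_of_surjective (LieSubmodule.Quotient.mk' (LieSubmodule.comap U.incl U'))
    ((LieSubmodule.Quotient.mk' W).comp U.incl) (LieSubmodule.Quotient.surjective_mk' _)
    (surjective_mk_comp_incl hsup) fun u => ?_
  rw [mk_subQuot_eq_zero]
  change _ ↔ LieSubmodule.Quotient.mk' W (u : Zh) = 0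
  rw [LieSubmodule.Quotient.mk_eq_zero]
  exact ⟨fun h => h1 h, fun h => h2 ((LieSubmodule.mem_inf _ _ _).mpr ⟨u.2, h⟩)⟩

/-- The map to an irreducible subquotient from the module generated by a stratum that it contains.
-/
def stratumMap (r : Fin 5) (hV : HasStratum V r) : stratumModule r →ₗ⁅ℂ,gl2HC⁆ SubQuot V W :=
  (LieSubmodule.Quotient.mk' _).comp (LieSubmodule.inclusion (stratumModule_le_iff.mpr hV))

theorem stratumMap_eq_zero {r : Fin 5} (hV : HasStratum V r) (u : stratumModule r) :
    stratumMap (W := W) r hV u = 0 ↔ (u : Zh) ∈ W :=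
  mk_subQuot_eq_zero

theorem stratumMap_surjective [LieModule.IsIrreducible ℂ gl2HC (SubQuot V W)] {r : Fin 5}
    (hV : HasStratum V r) (hW : ¬ HasStratum W r) :
    Function.Surjective (stratumMap (W := W) r hV) := by
  have hr : (stratumRep r).toZh ∈ stratumModule r := stratumModule_le_iff.mp le_rfl
  exact surjective_of_isIrreducible _ (u := ⟨_, hr⟩) fun h =>
    hW ((stratumMap_eq_zero hV _).mp h)

/-- An irreducible subquotient with the stratum `r` is isomorphic to each nonzero quotient of the
module generated by the stratum in which the strata other than `r` vanish. -/
theorem nonempty_subQuot_equiv [LieModule.IsIrreducible ℂ gl2HC (SubQuot V W)] {r : Fin 5}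
    (hV : HasStratum V r) (hW : ¬ HasStratum W r) {M : Type*} [AddCommGroup M] [Module ℂ M]
    [LieRingModule gl2HC M] [Nontrivial M] (g : stratumModule r →ₗ⁅ℂ,gl2HC⁆ M)
    (hg : Function.Surjective g) (U : LieSubmodule ℂ gl2HC Zh)
    (hU : ∀ s ∈ below r, s ≠ r → HasStratum U s)
    (hgU : ∀ u : stratumModule r, (u : Zh) ∈ U → g u = 0) :
    Nonempty (SubQuot V W ≃ₗ⁅ℂ, gl2HC⁆ M) := by
  have hle : stratumModule r ⊓ W ≤ U := le_iff_hasStratum.mpr fun s hs => by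
    have hs' := hasStratum_inf.mp hs
    exact hU s (hasStratum_stratumModule.mp hs'.1) fun e => hW (e ▸ hs'.2)
  obtain ⟨e, -⟩ := exists_equiv_of_isIrreducible (stratumMap (W := W) r hV) g
    (stratumMap_surjective hV hW) hg fun u hu => hgU u <|
      hle ((LieSubmodule.mem_inf _ _ _).mpr ⟨u.2, (stratumMap_eq_zero hV u).mp hu⟩)
  exact ⟨e⟩

/-- An irreducible subquotient contains only one stratum. -/
theorem eq_of_hasStratum_subQuot [LieModule.IsIrreducible ℂ gl2HC (SubQuot V W)] {r s : Fin 5}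
    (hVr : HasStratum V r) (hWr : ¬ HasStratum W r) (hVs : HasStratum V s)
    (hWs : ¬ HasStratum W s) : r = s := by
  have key : ∀ r s, HasStratum V r → ¬ HasStratum W r → HasStratum V s → ¬ HasStratum W s →
      s ∈ below r := by
    intro r s hVr hWr hVs hWs
    obtain ⟨u, hu⟩ := stratumMap_surjective (W := W) hVr hWr
      (LieSubmodule.Quotient.mk' _ ⟨(stratumRep s).toZh, hVs⟩)
    have hmem : (stratumRep s).toZh ∈ stratumModule r ⊔ W := by
      refine (LieSubmodule.mem_sup _ _ _).mpr ⟨u, u.2, (stratumRep s).toZh - u, ?_, by abel⟩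
      have h0 : LieSubmodule.Quotient.mk' (LieSubmodule.comap V.incl W)
          (⟨(stratumRep s).toZh, hVs⟩ - LieSubmodule.inclusion (stratumModule_le_iff.mpr hVr) u) =
          0 := by
        rw [map_sub, ← hu]
        exact sub_self _
      exact mk_subQuot_eq_zero.mp h0
    exact hasStratum_stratumModule.mp ((hasStratum_sup.mp hmem).resolve_right hWs)
  have h1 := key r s hVr hWr hVs hWs
  have h2 := key s r hVs hWs hVr hWr
  have hanti : ∀ r s : Fin 5, s ∈ below r → r ∈ below s → r = s := by decide
  exact hanti r s h1 h2

/-! ### Composition series -/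

/-- In a composition series each stratum appears in exactly one step, and each step adds exactly
one stratum. -/
theorem exists_stratum_equiv {n : ℕ} {c : Fin (n + 1) → LieSubmodule ℂ gl2HC Zh}
    (hc : IsCompositionSeries n c) :
    ∃ σ : Fin 5 ≃ Fin n, ∀ r, HasStratum (c (σ r).succ) r ∧
      ¬ HasStratum (c (σ r).castSucc) r := by
  obtain ⟨h0, hlast, hstep⟩ := hc
  have hmono : Monotone c := Fin.monotone_iff_le_succ.mpr fun i => (hstep i).1
  have hex : ∀ r, ∃ i : Fin n, HasStratum (c i.succ) r ∧ ¬ HasStratum (c i.castSucc) r := by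
    intro r
    by_contra! hcon
    have : ∀ i, ¬ HasStratum (c i) r := by
      intro i
      induction i using Fin.induction with
      | zero => rw [h0]; exact not_hasStratum_bot r
      | succ i ih => exact fun h => ih (hcon i h)
    exact this (Fin.last n) (hlast ▸ hasStratum_top r)
  choose σ hσ using hex
  refine ⟨Equiv.ofBijective σ ⟨fun r s h => ?_, fun i => ?_⟩, hσ⟩
  · have := (hstep (σ r)).2
    exact eq_of_hasStratum_subQuot (hσ r).1 (hσ r).2 (h ▸ (hσ s).1) (h ▸ (hσ s).2)
  · have hirr := (hstep i).2
    have hne : ∃ s, HasStratum (c i.succ) s ∧ ¬ HasStratum (c i.castSucc) s := by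
      by_contra! hcon
      have hle : c i.succ ≤ c i.castSucc := le_iff_hasStratum.mpr hcon
      obtain ⟨q, hq⟩ := @exists_ne (SubQuot (c i.succ) (c i.castSucc))
        (LieModule.nontrivial_of_isIrreducible ℂ gl2HC _) 0
      obtain ⟨v, rfl⟩ := LieSubmodule.Quotient.surjective_mk' _ q
      exact hq (mk_subQuot_eq_zero.mpr (hle v.2))
    obtain ⟨s, hs1, hs2⟩ := hne
    refine ⟨s, ?_⟩
    rcases lt_trichotomy (σ s) i with h | h | h
    · exact absurd (hmono (Fin.succ_le_castSucc_iff.mpr h) (hσ s).1) hs2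
    · exact h
    · exact absurd (hmono (Fin.succ_le_castSucc_iff.mpr h) hs1) (hσ s).2

/-- Adding the strata one after the other gives a composition series. -/
theorem isCompositionSeries_strata : IsCompositionSeries 5
    ![⊥, stratumModule 0, stratumModule 0 ⊔ stratumModule 2, stratumModule 3,
      stratumModule 3 ⊔ stratumModule 1, ⊤] := by
  refine ⟨rfl, rfl, fun i => ?_⟩
  have key : ∀ (V W : LieSubmodule ℂ gl2HC Zh) (r : Fin 5),
      (∀ s, HasStratum V s ↔ s = r ∨ HasStratum W s) → ¬ HasStratum W r →
      W ≤ V ∧ LieModule.IsIrreducible ℂ gl2HC (SubQuot V W) := by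
    intro V W r h hr
    refine ⟨le_iff_hasStratum.mpr fun s hs => (h s).mpr (Or.inr hs), ?_⟩
    exact isIrreducible_subQuot r ((h r).mpr (Or.inl rfl)) hr
      fun s hs hs' => ((h s).mp hs).resolve_right hs'
  fin_cases i
  · refine key (stratumModule 0) ⊥ 0 ?_ (not_hasStratum_bot 0)
    simp only [hasStratum_stratumModule, not_hasStratum_bot]
    decide
  · refine key (stratumModule 0 ⊔ stratumModule 2) (stratumModule 0) 2 ?_ ?_ <;>
      simp only [hasStratum_sup, hasStratum_stratumModule] <;> decide
  · refine key (stratumModule 3) (stratumModule 0 ⊔ stratumModule 2) 3 ?_ ?_ <;>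
      simp only [hasStratum_sup, hasStratum_stratumModule] <;> decide
  · refine key (stratumModule 3 ⊔ stratumModule 1) (stratumModule 3) 1 ?_ ?_ <;>
      simp only [hasStratum_sup, hasStratum_stratumModule] <;> decide
  · refine key ⊤ (stratumModule 3 ⊔ stratumModule 1) 4 ?_ ?_ <;>
      simp only [hasStratum_sup, hasStratum_stratumModule, hasStratum_top] <;> decide

end

end Quat

theorem theorem3 :
    ∃ P M Im Ip J : LieSubmodule ℂ gl2HC Zh,
      -- the five spaces
      (P.toSubmodule = ZhPlus ∧ P.toSubmodule = spanTN (fun _ k => 0 ≤ k)) ∧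
      (M.toSubmodule = ZhMinus 2 ∧ M.toSubmodule = spanTN (fun p k => k ≤ -(p + 3))) ∧
      Im.toSubmodule = spanTN (fun _ k => k ≤ -2) ∧
      Ip.toSubmodule = spanTN (fun p k => -(p + 1) ≤ k) ∧
      J.toSubmodule = spanTN (fun p k => -(p + 1) ≤ k ∧ k ≤ -2) ∧
      -- they and their sums are the only proper nonzero invariant subspaces
      (P ≠ ⊥ ∧ M ≠ ⊥ ∧ Im ≠ ⊥ ∧ Ip ≠ ⊥ ∧ J ≠ ⊥) ∧
      (P ≠ ⊤ ∧ M ≠ ⊤ ∧ Im ≠ ⊤ ∧ Ip ≠ ⊤ ∧ J ≠ ⊤) ∧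
      Im ⊔ Ip = ⊤ ∧
      (∀ W : LieSubmodule ℂ gl2HC Zh, (W ≠ ⊥ ∧ W ≠ ⊤) ↔
        ∃ S : Set (LieSubmodule ℂ gl2HC Zh), S ⊆ {P, M, Im, Ip, J} ∧ S.Nonempty ∧
          ¬ (Im ∈ S ∧ Ip ∈ S) ∧ W = sSup S) ∧
      -- the irreducible components
      LieModule.IsIrreducible ℂ gl2HC P ∧
      LieModule.IsIrreducible ℂ gl2HC M ∧
      LieModule.IsIrreducible ℂ gl2HC J ∧
      LieModule.IsIrreducible ℂ gl2HC (Zh ⧸ (Im ⊔ P)) ∧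
      LieModule.IsIrreducible ℂ gl2HC (Zh ⧸ (M ⊔ Ip)) ∧
      (Disjoint Im P ∧ Disjoint P J ∧ Disjoint M Ip ∧ Disjoint M J) ∧
      -- the two quotients are also the quotients of `Ip` and `Im`, via the inclusions
      (∃ e : SubQuot Ip (P ⊔ J) ≃ₗ⁅ℂ, gl2HC⁆ (Zh ⧸ (Im ⊔ P)),
        ∀ x : Ip, e (LieSubmodule.Quotient.mk x) = LieSubmodule.Quotient.mk (x : Zh)) ∧
      (∃ e : SubQuot Im (M ⊔ J) ≃ₗ⁅ℂ, gl2HC⁆ (Zh ⧸ (M ⊔ Ip)),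
        ∀ x : Im, e (LieSubmodule.Quotient.mk x) = LieSubmodule.Quotient.mk (x : Zh)) ∧
      -- there are no others: composition series exist, and the factors of any of them are
      -- these five modules, each occurring exactly once
      (∃ (n : ℕ) (c : Fin (n + 1) → LieSubmodule ℂ gl2HC Zh), IsCompositionSeries n c) ∧
      (∀ (n : ℕ) (c : Fin (n + 1) → LieSubmodule ℂ gl2HC Zh), IsCompositionSeries n c →
        ∃ σ : Fin 5 ≃ Fin n,
          Nonempty (SubQuot (c (σ 0).succ) (c (σ 0).castSucc) ≃ₗ⁅ℂ, gl2HC⁆ P) ∧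
          Nonempty (SubQuot (c (σ 1).succ) (c (σ 1).castSucc) ≃ₗ⁅ℂ, gl2HC⁆ M) ∧
          Nonempty (SubQuot (c (σ 2).succ) (c (σ 2).castSucc) ≃ₗ⁅ℂ, gl2HC⁆ J) ∧
          Nonempty (SubQuot (c (σ 3).succ) (c (σ 3).castSucc) ≃ₗ⁅ℂ, gl2HC⁆ (Zh ⧸ (Im ⊔ P))) ∧
          Nonempty (SubQuot (c (σ 4).succ) (c (σ 4).castSucc) ≃ₗ⁅ℂ, gl2HC⁆ (Zh ⧸ (M ⊔ Ip)))) := by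
  have hirr : ∀ r : Fin 5, below r = {r} →
      LieModule.IsIrreducible ℂ gl2HC (stratumModule r) := fun r hr =>
    isIrreducible_submodule r (hasStratum_stratumModule.mpr (by simp [hr])) fun s hs => by
      simpa [hr] using hasStratum_stratumModule.mp hs
  have hquot : ∀ r u v : Fin 5, (∀ s, ¬ (s ∈ below u ∨ s ∈ below v) ↔ s = r) →
      LieModule.IsIrreducible ℂ gl2HC (Zh ⧸ (stratumModule u ⊔ stratumModule v)) := by
    intro r u v h
    have h' : ∀ s, ¬ HasStratum (stratumModule u ⊔ stratumModule v) s ↔ s = r := by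
      simpa only [hasStratum_sup, hasStratum_stratumModule] using h
    exact isIrreducible_quotient r ((h' r).mpr rfl) fun s => (h' s).mp
  have hdisj : ∀ r s : Fin 5, Disjoint (below r) (below s) →
      Disjoint (stratumModule r) (stratumModule s) := fun r s h =>
    disjoint_of_hasStratum fun t ht ht' => Finset.disjoint_left.mp h
      (hasStratum_stratumModule.mp ht) (hasStratum_stratumModule.mp ht')
  have hsup3 : stratumModule 3 ⊔ (stratumModule 4 ⊔ stratumModule 0) = ⊤ :=
    eq_top_iff_hasStratum.mpr <| by
      simp only [hasStratum_sup, hasStratum_stratumModule]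
      decide
  have hsup4 : stratumModule 4 ⊔ (stratumModule 1 ⊔ stratumModule 3) = ⊤ :=
    eq_top_iff_hasStratum.mpr <| by
      simp only [hasStratum_sup, hasStratum_stratumModule]
      decide
  have hirr3 := hquot 3 4 0 (by decide)
  have hirr4 := hquot 4 1 3 (by decide)
  refine ⟨stratumModule 0, stratumModule 1, stratumModule 4, stratumModule 3, stratumModule 2,
    ⟨spanTN_eq_ZhPlus, rfl⟩, ⟨spanTN_eq_ZhMinus, rfl⟩, rfl, rfl, rfl, ?_, ?_, ?_,
    ne_bot_and_ne_top_iff, hirr 0 rfl, hirr 1 rfl, hirr 2 rfl, hirr3, hirr4,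
    ⟨hdisj 4 0 (by decide), hdisj 0 2 (by decide), hdisj 1 3 (by decide), hdisj 1 2 (by decide)⟩,
    exists_subQuot_equiv hsup3 ?_ ?_, exists_subQuot_equiv hsup4 ?_ ?_,
    ⟨5, _, isCompositionSeries_strata⟩, ?_⟩
  · have h : ∀ r, stratumModule r ≠ ⊥ := fun r e =>
      not_hasStratum_bot r (e ▸ stratumModule_le_iff.mp le_rfl)
    exact ⟨h 0, h 1, h 4, h 3, h 2⟩
  · have h : ∀ r s, s ∉ below r → stratumModule r ≠ ⊤ := fun r s hs e =>
      hs (hasStratum_stratumModule.mp (e ▸ hasStratum_top s))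
    exact ⟨h 0 1 (by decide), h 1 0 (by decide), h 4 0 (by decide), h 3 1 (by decide),
      h 2 0 (by decide)⟩
  · rw [eq_top_iff_hasStratum]
    simp only [hasStratum_sup, hasStratum_stratumModule]
    decide
  · rw [le_iff_hasStratum]
    simp only [hasStratum_sup, hasStratum_stratumModule]
    decide
  · rw [le_iff_hasStratum]
    simp only [hasStratum_inf, hasStratum_sup, hasStratum_stratumModule]
    decide
  · rw [le_iff_hasStratum]
    simp only [hasStratum_sup, hasStratum_stratumModule]
    decide
  · rw [le_iff_hasStratum]
    simp only [hasStratum_inf, hasStratum_sup, hasStratum_stratumModule]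
    decide
  · intro n c hc
    obtain ⟨σ, hσ⟩ := exists_stratum_equiv hc
    have hsimple : ∀ r, below r = {r} → Nonempty
        (SubQuot (c (σ r).succ) (c (σ r).castSucc) ≃ₗ⁅ℂ, gl2HC⁆ stratumModule r) := by
      intro r hr
      have := (hc.2.2 (σ r)).2
      have := hirr r hr
      have := LieModule.nontrivial_of_isIrreducible ℂ gl2HC (stratumModule r)
      refine nonempty_subQuot_equiv (hσ r).1 (hσ r).2 LieModuleHom.id Function.surjective_id ⊥
        (fun s hs hsr => absurd (by simpa [hr] using hs) hsr) fun u hu => ?_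
      exact Subtype.ext ((LieSubmodule.mem_bot _).mp hu)
    have htop : ∀ (r : Fin 5) (U : LieSubmodule ℂ gl2HC Zh), stratumModule r ⊔ U = ⊤ →
        (∀ s ∈ below r, s ≠ r → HasStratum U s) → LieModule.IsIrreducible ℂ gl2HC (Zh ⧸ U) →
        Nonempty (SubQuot (c (σ r).succ) (c (σ r).castSucc) ≃ₗ⁅ℂ, gl2HC⁆ (Zh ⧸ U)) := by
      intro r U hsup hU hUirr
      have := (hc.2.2 (σ r)).2
      have := LieModule.nontrivial_of_isIrreducible ℂ gl2HC (Zh ⧸ U)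
      exact nonempty_subQuot_equiv (hσ r).1 (hσ r).2 _ (surjective_mk_comp_incl hsup) U hU
        fun u hu => (LieSubmodule.Quotient.mk_eq_zero U).mpr hu
    refine ⟨σ, hsimple 0 rfl, hsimple 1 rfl, hsimple 2 rfl, htop 3 _ hsup3 ?_ hirr3,
      htop 4 _ hsup4 ?_ hirr4⟩ <;>
    · simp only [hasStratum_sup, hasStratum_stratumModule]
      decide
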